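/- **Setting.** Let $V,H$ be real Hilbert spaces forming a Gelfand triple $V\hookrightarrow H\cong H^*\hookrightarrow V^*$, where the embedding of $V$ into $H$ is compact and dense. Let $a:V\times V\to\mathbb R$ be a continuous bilinear form for which there are $\alpha_0>0$, $\omega_0\ge 0$ with $a(v,v)+\omega_0\|v\|_H^2\ge\alpha_0\|v\|_V^2$ for all $v\in V$, and let $A:V\to V^*$, $\langle Ay,v\rangle=a(y,v)$. Let $(\omega,\varrho)$ be a measure space, $B:L^2(\omega)\to V^*$ linear and continuous, $u_a,u_b\in L^\infty(\omega)$ with $u_a<u_b$ a.e., $y_0,y_d\in H$ and $\delta_0>0$. Put $$U_{ad}=\{w\in L^2(\omega): u_a\le w\le u_b \text{ a.e.}\},\qquad U_{ad}(0,T)=\{u\in L^2((0,T);L^2(\omega)) : u(t)\in U_{ad}\text{ for a.e. }t\in(0,T)\},$$ and assume that $U_{ad}$ is bounded in $L^2(\omega)$ (which is automatic if $\varrho(\omega)<\infty$). For $u\in U_{ad}(0,T)$ let $y[u]\in L^2(0,T;V)\cap H^1(0,T;V^*)\subset C([0,T];H)$ be the solution of $\partial_t y+Ay=Bu$ in $(0,T)$,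 $y(0)=y_0$. Assume that $\|y_0-y_d\|_H>\delta_0$ and that there are $T>0$ and $u\in U_{ad}(0,T)$ with $\|y[u](T)-y_d\|_H\le\delta_0$. For $\delta\ge0$ consider the time-optimal control problem $$(P_\delta)\qquad \text{minimize } T \text{ subject to } T>0,\ u\in U_{ad}(0,T),\ \|y[u](T)-y_d\|_H\le\delta_0+\delta,$$ and for $T>0$ the minimal distance problem $$(\delta_T)\qquad \text{minimize } \|y[u](T)-y_d\|_H-\delta_0\text{ subject to } u\in U_{ad}(0,T).$$ Solutions $(T,u)$ of $(P_\delta)$ are called time-optimal for $(P_\delta)$, and solutions $u$ of $(\delta_T)$ are called distance-optimal for $(\delta_T)$. Let $T(\delta)=\inf (P_\delta)\in[0,\infty]$ and $\delta(T)=\inf(\delta_T)$ be the value functions, and let $\delta^\bullet=\|y_0-y_d\|_H-\delta_0$. **Theorem.** Assume that the function $T(\cdot)$ is left-continuous on $[0,\infty)$. 1. Suppose that $T(\delta^\bullet)=0$, i.e. that the distance $\|y_0-y_d\|_H$ to $y_d$ can be attained or undercut at arbitrarily small positive times. If $T\in(0,T(0)]$ and $u\in U_{ad}(0,T)$ is distance-optimal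 for $(\delta_T)$, then $\delta(T)\ge 0$ and $(T,u)$ is time-optimal for $(P_{\delta(T)})$. 2. If $\delta\in[0,\delta^\bullet)$ and $(T,u)$ with $T>0$, $u\in U_{ad}(0,T)$ is time-optimal for $(P_\delta)$, then $u$ is distance-optimal for $(\delta_T)$. -/

import Mathlib

open MeasureTheory Set
open scoped ENNReal ContDiff

noncomputable section

namespace ParabolicControl

/-- The data of the control system: real Hilbert spaces `V ↪ H` forming a Gelfand triple
(`j` is the compact, dense embedding of `V` into `H`), a continuous bilinear form `a` on `V`
satisfying the Garding inequality, a control operator `B : L²(ω, ρ) → V*`, control bounds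
`ua < ub` in `L^∞(ω, ρ)`, the initial state `y₀`, the desired state `yd` and the radius `δ₀ > 0`. -/
structure ControlSystem (V H : Type*) {Ω : Type*}
    [NormedAddCommGroup V] [InnerProductSpace ℝ V] [CompleteSpace V]
    [NormedAddCommGroup H] [InnerProductSpace ℝ H] [CompleteSpace H]
    [MeasurableSpace Ω] (ρ : Measure Ω) where
  j : V →L[ℝ] H
  j_injective : Function.Injective j
  j_denseRange : DenseRange j
  j_compact : IsCompactOperator j
  /-- The bilinear form, curried; as a map `V → V*` it is the operator `A`. -/
  a : V →L[ℝ] V →L[ℝ] ℝ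
  garding : ∃ α₀ : ℝ, 0 < α₀ ∧ ∃ ω₀ : ℝ, 0 ≤ ω₀ ∧
    ∀ v : V, α₀ * ‖v‖ ^ 2 ≤ a v v + ω₀ * ‖j v‖ ^ 2
  B : Lp ℝ 2 ρ →L[ℝ] V →L[ℝ] ℝ
  ua : Lp ℝ ∞ ρ
  ub : Lp ℝ ∞ ρ
  ua_lt_ub : ∀ᵐ x ∂ρ, ua x < ub x
  y₀ : H
  yd : H
  δ₀ : ℝ
  δ₀_pos : 0 < δ₀

/-- The Lebesgue measure on the time interval `(0, T)`. -/
abbrev timeMeasure (T : ℝ) : Measure ℝ := volume.restrict (Ioo 0 T)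

/-- The space of controls `U(0, T) = L²((0, T); L²(ω, ρ))`. -/
abbrev Control {Ω : Type*} [MeasurableSpace Ω] (ρ : Measure Ω) (T : ℝ) :=
  Lp (Lp ℝ 2 ρ) 2 (timeMeasure T)

/-- `g` is the weak (distributional) derivative of `f` on `(0, T)`. -/
def IsWeakTimeDeriv {X : Type*} [NormedAddCommGroup X] [NormedSpace ℝ X]
    (T : ℝ) (f g : ℝ → X) : Prop :=
  ∀ φ : ℝ → ℝ, ContDiff ℝ ∞ φ → HasCompactSupport φ → tsupport φ ⊆ Ioo 0 T →
    ∫ t in Ioo 0 T, deriv φ t • f t = - ∫ t in Ioo 0 T, φ t • g t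

namespace ControlSystem

variable {V H Ω : Type*}
  [NormedAddCommGroup V] [InnerProductSpace ℝ V] [CompleteSpace V]
  [NormedAddCommGroup H] [InnerProductSpace ℝ H] [CompleteSpace H]
  [MeasurableSpace Ω] {ρ : Measure Ω} (S : ControlSystem V H ρ)

/-- The embedding `H ≅ H* ↪ V*`, `h ↦ (v ↦ (h, j v)_H)`. -/
def toDual (h : H) : V →L[ℝ] ℝ := (innerSL ℝ h).comp S.j

/-- The admissible control values `U_ad ⊆ L²(ω, ρ)`. -/
def Uad : Set (Lp ℝ 2 ρ) := {w | ∀ᵐ x ∂ρ, S.ua x ≤ w x ∧ w x ≤ S.ub x}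

/-- The admissible controls `U_ad(0, T)`. -/
def UadT (T : ℝ) : Set (Control ρ T) := {u | ∀ᵐ t ∂(timeMeasure T), u t ∈ S.Uad}

/-- `y = y[u]` on `[0, T]`: `y` is (the `H`-continuous representative on `[0, T]` of) an element of
`W(0, T) = H¹(0, T; V*) ∩ L²(0, T; V)` with `∂ₜ y + A y = B u` in `(0, T)` and `y(0) = y₀`.
Here `v` is `y` regarded as an element of `L²(0, T; V)`. Since `B u - A v` is in `L²(0, T; V*)`,
the equation for the weak derivative contains `y ∈ H¹(0, T; V*)`. -/
def IsState (T : ℝ) (u : Control ρ T) (y : ℝ → H) : Prop :=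
  ContinuousOn y (Icc 0 T) ∧ y 0 = S.y₀ ∧
    ∃ v : Lp V 2 (timeMeasure T),
      (∀ᵐ t ∂(timeMeasure T), y t = S.j (v t)) ∧
      IsWeakTimeDeriv T (fun t => S.toDual (S.j (v t))) (fun t => S.B (u t) - S.a (v t))

/-- `(T, u)` is feasible for the time-optimal control problem `(P_δ)`. -/
def IsFeasible (δ T : ℝ) (u : Control ρ T) : Prop :=
  0 < T ∧ u ∈ S.UadT T ∧ ∃ y : ℝ → H, S.IsState T u y ∧ ‖y T - S.yd‖ ≤ S.δ₀ + δ

/-- `(T, u)` is time-optimal for `(P_δ)`. -/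
def IsTimeOptimal (δ T : ℝ) (u : Control ρ T) : Prop :=
  S.IsFeasible δ T u ∧
    ∀ (T' : ℝ) (u' : Control ρ T'), S.IsFeasible δ T' u' → T ≤ T'

/-- `u` is distance-optimal for the minimal distance control problem `(δ_T)`. -/
def IsDistanceOptimal (T : ℝ) (u : Control ρ T) : Prop :=
  u ∈ S.UadT T ∧ ∃ y : ℝ → H, S.IsState T u y ∧
    ∀ u' ∈ S.UadT T, ∀ y' : ℝ → H, S.IsState T u' y' →
      ‖y T - S.yd‖ - S.δ₀ ≤ ‖y' T - S.yd‖ - S.δ₀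

/-- The time value function `T(δ) = inf (P_δ)`, with values in `[0, ∞]`. -/
def timeValue (δ : ℝ) : ℝ≥0∞ :=
  ⨅ (T : ℝ) (u : Control ρ T) (_ : S.IsFeasible δ T u), ENNReal.ofReal T

/-- The distance value function `δ(T) = inf (δ_T)`. -/
def distanceValue (T : ℝ) : ℝ :=
  sInf {r : ℝ | ∃ u ∈ S.UadT T, ∃ y : ℝ → H, S.IsState T u y ∧ r = ‖y T - S.yd‖ - S.δ₀}

/-- `δ^• = ‖y₀ - y_d‖ - δ₀`. -/
def deltaBullet : ℝ := ‖S.y₀ - S.yd‖ - S.δ₀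

end ControlSystem

end ParabolicControl

end

/-!
The second assertion needs no theory of the state equation: if another control on `(0, T)` ended
strictly closer to `y_d`, its trajectory, being continuous in `H`, would have entered the target
ball before time `T`, and stopping it there (`exists_isFeasible_lt`) contradicts the
time-optimality.

For the first assertion let `u` be distance-optimal for `T`, with optimal value `d = δ(T)`. The
same stopping argument for the tolerance `0` gives `d ≥ 0`. Let `δ*` be the supremum of the
tolerances whose time value is at least `T`. By left-continuity it is attained
(`exists_critical_tolerance`), while every tolerance above `δ*` can be met before `T`. Feasible
times `T_n < T` for tolerances decreasing to `δ*` accumulate at some `T' ≤ T`; they do not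
accumulate at `0` because `δ* < δ^•` (`pos_of_tendsto_isFeasible`), and by compactness `T'` is
feasible for `δ*` (`exists_isFeasible_of_tendsto`). Hence `T' = T`, so `d ≤ δ*`, and the
monotonicity of the time value function shows that no time below `T` is feasible for `d`.

The compactness theorem carries the analytic weight. Neither the general existence theory for
parabolic equations nor weak compactness is used. Bounded sequences of controls have strongly
convergent convex combinations of their tails (`exists_tendsto_convexHull_tail`), and the set of
admissible controls whose state exists up to a time `s < T'`, with prescribed bounds on the
components of the final state, is convex and closed under strong limits. Here one uses the energy
identity for functions in `L²(0, T; V)` with derivative in `L²(0, T; V*)`, proved by Steklov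
averages, and the resulting a priori estimate `exists_energy_bound`. The limit control therefore
has a state on every `[0, s]`, `s < T'`; uniqueness glues these states, and
`exists_tendsto_endpoint` extends the result continuously up to `T'`. The distance bound passes to
the limit because the states are uniformly Hölder continuous with values in `V*`.
-/

open MeasureTheory Set
open scoped ENNReal ContDiff

namespace ParabolicControl

open Filter Topology

/-! ### Weak and integrated time derivatives -/

/-- Integration by parts of a smooth function with compact support in `(0, T)` against the
primitive of an integrable function. -/
theorem integral_deriv_mul_primitive {T : ℝ} {q φ : ℝ → ℝ}
    (hq : IntervalIntegrable q volume 0 T) (hφ : ContDiff ℝ ∞ φ) (hsupp : tsupport φ ⊆ Ioo 0 T) :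
    ∫ t in (0 : ℝ)..T, deriv φ t * ∫ τ in (0 : ℝ)..t, q τ = - ∫ t in (0 : ℝ)..T, φ t * q t := by
  have hQ := hq.absolutelyContinuousOnInterval_intervalIntegral (c := 0) (by simp)
  have hφac : AbsolutelyContinuousOnInterval φ 0 T :=
    ((hφ.of_le (by norm_cast)).contDiffOn).absolutelyContinuousOnInterval
  have key := hφac.integral_mul_deriv_eq_deriv_mul hQ
  have h0 : φ 0 = 0 := image_eq_zero_of_notMem_tsupport fun h => lt_irrefl _ (hsupp h).1
  have hT' : φ T = 0 := image_eq_zero_of_notMem_tsupport fun h => lt_irrefl _ (hsupp h).2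
  have hc : ∫ t in (0 : ℝ)..T, φ t * deriv (fun x => ∫ τ in (0 : ℝ)..x, q τ) t
      = ∫ t in (0 : ℝ)..T, φ t * q t := by
    apply intervalIntegral.integral_congr_ae
    filter_upwards [hq.ae_hasDerivAt_integral] with t ht htm
    rw [(ht (uIoc_subset_uIcc htm) 0 (by simp)).deriv]
  rw [hc, h0, hT'] at key
  linarith

/-- A smooth function with compact support in `(0, T)` and vanishing mean has a primitive of the
same kind. -/
theorem exists_testFunction_primitive {T : ℝ} {ψ : ℝ → ℝ} (hψ : ContDiff ℝ ∞ ψ)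
    (hc : HasCompactSupport ψ) (hsupp : tsupport ψ ⊆ Ioo 0 T) (hmean : ∫ t, ψ t = 0) :
    ∃ φ : ℝ → ℝ, ContDiff ℝ ∞ φ ∧ HasCompactSupport φ ∧ tsupport φ ⊆ Ioo 0 T ∧ deriv φ = ψ := by
  have hcont := hψ.continuous
  have hd : ∀ t, HasDerivAt (fun t => ∫ τ in (0 : ℝ)..t, ψ τ) (ψ t) t := fun t =>
    intervalIntegral.integral_hasDerivAt_right (hcont.intervalIntegrable _ _)
      (hcont.stronglyMeasurableAtFilter _ _) hcont.continuousAt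
  have hderiv : deriv (fun t => ∫ τ in (0 : ℝ)..t, ψ τ) = ψ := funext fun t => (hd t).deriv
  -- an interval `[a, b]` with `0 < a`, `b < T` outside which `ψ` vanishes
  obtain ⟨a, b, ha, hb, hab⟩ : ∃ a b : ℝ, 0 < a ∧ b < T ∧ tsupport ψ ⊆ Icc a b := by
    rcases (tsupport ψ).eq_empty_or_nonempty with he | hne
    · exact ⟨1, T - 1, one_pos, by linarith, by simp [he]⟩
    · have hcomp : IsCompact (tsupport ψ) := hc
      obtain ⟨a, ha, hamin⟩ := hcomp.exists_isLeast hne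
      obtain ⟨b, hb, hbmax⟩ := hcomp.exists_isGreatest hne
      exact ⟨a, b, (hsupp ha).1, (hsupp hb).2, fun x hx => ⟨hamin hx, hbmax hx⟩⟩
  have hz : ∀ t, t ∉ Icc a b → ψ t = 0 := fun t ht =>
    image_eq_zero_of_notMem_tsupport fun h => ht (hab h)
  have hsub : Function.support (fun t => ∫ τ in (0 : ℝ)..t, ψ τ) ⊆ Icc a b := by
    intro t ht
    by_contra hcon
    apply ht
    rcases lt_or_ge t a with hta | hta
    · have : ∀ τ ∈ uIcc 0 t, ψ τ = 0 := by
        intro τ hτ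
        apply hz
        intro h
        rcases mem_uIcc.1 hτ with h1 | h1 <;> linarith [h1.1, h1.2, h.1]
      simp only
      rw [intervalIntegral.integral_congr (g := fun _ => (0 : ℝ)) this]; simp
    · have htb : b < t := by
        by_contra h
        exact hcon ⟨hta, not_lt.1 h⟩
      simp only
      rw [intervalIntegral.integral_eq_integral_of_support_subset, hmean]
      intro τ hτ
      have h' : τ ∈ Icc a b := by
        by_contra h
        exact hτ (hz τ h)
      exact ⟨by linarith [h'.1], by linarith [h'.2]⟩
  have hts : tsupport (fun t => ∫ τ in (0 : ℝ)..t, ψ τ) ⊆ Icc a b :=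
    closure_minimal hsub isClosed_Icc
  refine ⟨_, ?_, ?_, ?_, hderiv⟩
  · refine contDiff_infty_iff_deriv.2 ⟨fun t => (hd t).differentiableAt, ?_⟩
    rw [hderiv]; exact hψ
  · exact isCompact_Icc.of_isClosed_subset (isClosed_tsupport _) hts
  · exact fun t ht => ⟨by linarith [(hts ht).1], by linarith [(hts ht).2]⟩

/-- Du Bois-Reymond: a continuous function on `[0, T]` whose weak derivative vanishes is
constant. -/
theorem eq_const_of_integral_deriv_mul_eq_zero {T : ℝ} (hT : 0 < T) {P : ℝ → ℝ}
    (hP : ContinuousOn P (Icc 0 T))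
    (h : ∀ φ : ℝ → ℝ, ContDiff ℝ ∞ φ → HasCompactSupport φ → tsupport φ ⊆ Ioo 0 T →
      ∫ t in Ioo 0 T, deriv φ t * P t = 0) :
    ∀ t ∈ Icc 0 T, P t = P 0 := by
  -- a bump function `χ` with integral one
  let f : ContDiffBump (T / 2) := ⟨T / 8, T / 4, by positivity, by linarith⟩
  have hχs : tsupport (f.normed volume) ⊆ Ioo 0 T := by
    rw [f.tsupport_normed_eq, Real.closedBall_eq_Icc]
    intro x hx
    have h1 : f.rOut = T / 4 := rfl
    rw [h1] at hx
    exact ⟨by linarith [hx.1], by linarith [hx.2]⟩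
  set χ := f.normed volume with hχ
  have hχc : ContDiff ℝ ∞ χ := f.contDiff_normed
  have hχcs : HasCompactSupport χ := f.hasCompactSupport_normed
  have hχi : ∫ t, χ t = 1 := f.integral_normed
  have hint : ∀ ψ : ℝ → ℝ, Continuous ψ → IntegrableOn (fun t => ψ t * P t) (Ioo 0 T) :=
    fun ψ hψ => ((hψ.continuousOn.mul hP).integrableOn_Icc).mono_set Ioo_subset_Icc_self
  set k := ∫ t in Ioo 0 T, χ t * P t with hk
  have hae : ∀ᵐ t, t ∈ Ioo 0 T → P t - k = 0 := by
    apply isOpen_Ioo.ae_eq_zero_of_integral_contDiff_smul_eq_zero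
    · exact (((hP.sub continuousOn_const).integrableOn_Icc).mono_set
        Ioo_subset_Icc_self).locallyIntegrableOn
    · intro ψ hψ hψc hψs
      set c := ∫ t, ψ t with hc
      have hψi : Integrable ψ := hψ.continuous.integrable_of_hasCompactSupport hψc
      have hχint : Integrable χ := hχc.continuous.integrable_of_hasCompactSupport hχcs
      obtain ⟨φ, h1, h2, h3, h4⟩ := exists_testFunction_primitive (T := T)
        (ψ := fun t => ψ t - c * χ t) (hψ.sub (contDiff_const.mul hχc))
        (hψc.sub (hχcs.mul_left)) (by
          refine (tsupport_sub _ _).trans (union_subset hψs ?_)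
          exact (tsupport_mul_subset_right).trans hχs) (by
          rw [integral_sub hψi (hχint.const_mul c), integral_const_mul, hχi]; simp [hc])
      have h5 := h φ h1 h2 h3
      rw [h4] at h5
      have h6 : ∫ t in Ioo 0 T, (ψ t - c * χ t) * P t
          = (∫ t in Ioo 0 T, ψ t * P t) - c * k := by
        rw [hk, ← integral_const_mul, ← integral_sub (hint _ hψ.continuous)
          ((hint _ hχc.continuous).const_mul c)]
        congr 1; ext t; ring
      have h7 : ∫ t, ψ t • (P t - k) = ∫ t in Ioo 0 T, ψ t * (P t - k) := by
        rw [setIntegral_eq_integral_of_forall_compl_eq_zero]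
        · simp
        · intro t ht
          rw [image_eq_zero_of_notMem_tsupport fun h => ht (hψs h), zero_mul]
      have h8 : ∫ t in Ioo 0 T, ψ t = c := by
        rw [setIntegral_eq_integral_of_forall_compl_eq_zero]
        intro t ht
        exact image_eq_zero_of_notMem_tsupport fun h => ht (hψs h)
      have h9 : ∫ t in Ioo 0 T, ψ t * (P t - k) = (∫ t in Ioo 0 T, ψ t * P t) - c * k := by
        rw [← h8, ← integral_mul_const, ← integral_sub (hint _ hψ.continuous)
          (hψi.integrableOn.mul_const k)]
        congr 1; ext t; ring
      rw [h7, h9, ← h6, h5]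
  have hall : EqOn P (fun _ => k) (Icc 0 T) := by
    have h1 : P =ᵐ[volume.restrict (Icc 0 T)] fun _ => k := by
      rw [← restrict_Ioo_eq_restrict_Icc, EventuallyEq, ae_restrict_iff' measurableSet_Ioo]
      filter_upwards [hae] with t ht hm
      linarith [ht hm]
    exact Measure.eqOn_Icc_of_ae_eq volume hT.ne h1 hP continuousOn_const
  intro t ht
  rw [hall ht, hall ⟨le_rfl, hT.le⟩]

/-- The weak derivative of a continuous function is its derivative in the integrated sense. -/
theorem sub_eq_integral_iff_weakDeriv {T : ℝ} (hT : 0 < T) {p q : ℝ → ℝ}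
    (hp : ContinuousOn p (Icc 0 T)) (hq : IntegrableOn q (Ioo 0 T)) :
    (∀ t ∈ Icc 0 T, p t - p 0 = ∫ τ in (0 : ℝ)..t, q τ) ↔
    ∀ φ : ℝ → ℝ, ContDiff ℝ ∞ φ → HasCompactSupport φ → tsupport φ ⊆ Ioo 0 T →
      ∫ t in Ioo 0 T, deriv φ t * p t = - ∫ t in Ioo 0 T, φ t * q t := by
  have hqi : IntervalIntegrable q volume 0 T := by
    rwa [intervalIntegrable_iff_integrableOn_Ioo_of_le hT.le]
  have hQc : ContinuousOn (fun t => ∫ τ in (0 : ℝ)..t, q τ) (Icc 0 T) := by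
    have := (hqi.absolutelyContinuousOnInterval_intervalIntegral (c := 0) (by simp)).continuousOn
    rwa [uIcc_of_le hT.le] at this
  have hIoo : ∀ F : ℝ → ℝ, ∫ t in (0 : ℝ)..T, F t = ∫ t in Ioo 0 T, F t := fun F => by
    rw [intervalIntegral.integral_of_le hT.le, integral_Ioc_eq_integral_Ioo]
  have hd : ∀ φ : ℝ → ℝ, ContDiff ℝ ∞ φ → Continuous (deriv φ) := fun φ hφ =>
    (contDiff_infty_iff_deriv.1 hφ).2.continuous
  have hint : ∀ ψ F : ℝ → ℝ, Continuous ψ → ContinuousOn F (Icc 0 T) →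
      IntegrableOn (fun t => ψ t * F t) (Ioo 0 T) := fun ψ F hψ hF =>
    ((hψ.continuousOn.mul hF).integrableOn_Icc).mono_set Ioo_subset_Icc_self
  have hibp : ∀ φ : ℝ → ℝ, ContDiff ℝ ∞ φ → tsupport φ ⊆ Ioo 0 T →
      ∫ t in Ioo 0 T, deriv φ t * (∫ τ in (0 : ℝ)..t, q τ) = - ∫ t in Ioo 0 T, φ t * q t := by
    intro φ h1 h3
    have := integral_deriv_mul_primitive hqi h1 h3
    rwa [hIoo, hIoo] at this
  have hmean : ∀ φ : ℝ → ℝ, ContDiff ℝ ∞ φ → tsupport φ ⊆ Ioo 0 T →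
      ∫ t in Ioo 0 T, deriv φ t * p 0 = 0 := by
    intro φ h1 h3
    rw [integral_mul_const, ← hIoo, intervalIntegral.integral_deriv_eq_sub'
      _ rfl (fun x _ => (contDiff_infty_iff_deriv.1 h1).1 x) (hd φ h1).continuousOn,
      image_eq_zero_of_notMem_tsupport fun h => lt_irrefl _ (h3 h).1,
      image_eq_zero_of_notMem_tsupport fun h => lt_irrefl _ (h3 h).2]
    simp
  constructor
  · intro h φ h1 h2 h3
    rw [← hibp φ h1 h3]
    have h4 : ∫ t in Ioo 0 T, deriv φ t * p t
        = ∫ t in Ioo 0 T, (deriv φ t * (∫ τ in (0 : ℝ)..t, q τ) + deriv φ t * p 0) := by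
      apply setIntegral_congr_fun measurableSet_Ioo
      intro t ht
      have := h t (Ioo_subset_Icc_self ht)
      simp only
      rw [← this]; ring
    rw [h4, integral_add (hint _ _ (hd φ h1) hQc) (hint _ _ (hd φ h1) continuousOn_const),
      hmean φ h1 h3, add_zero]
  · intro h t ht
    have key := eq_const_of_integral_deriv_mul_eq_zero hT (hp.sub hQc) (by
      intro φ h1 h2 h3
      have h4 := h φ h1 h2 h3
      rw [← hibp φ h1 h3] at h4
      simp only [Pi.sub_apply, mul_sub]
      rw [integral_sub (hint _ _ (hd φ h1) hp) (hint _ _ (hd φ h1) hQc), h4, sub_self])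
    have := key t ht
    simp at this
    linarith

/-! ### Translations and Steklov averages in `L²` -/

theorem tendsto_eLpNorm_translate_sub {X : Type*} [NormedAddCommGroup X]
    {f : ℝ → X} (hf : MemLp f 2 volume) :
    Tendsto (fun r : ℝ => eLpNorm (fun t => f (t + r) - f t) 2 volume) (𝓝 0) (𝓝 0) := by
  let g : C(ℝ, C(ℝ, ℝ)) := (ContinuousMap.mk (fun a : ℝ × ℝ => a.2 + a.1)
    (continuous_snd.add continuous_fst)).curry
  have hg : ∀ r, MeasurePreserving (g r) volume volume := fun r =>
    measurePreserving_add_right volume r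
  have h1 : Tendsto (fun r => Lp.compMeasurePreserving (g r) (hg r) (hf.toLp f)) (𝓝 0)
      (𝓝 (Lp.compMeasurePreserving (g 0) (hg 0) (hf.toLp f))) :=
    tendsto_const_nhds.compMeasurePreservingLp (g.continuous.tendsto 0) hg (hg 0) (by simp)
  rw [Lp.tendsto_Lp_iff_tendsto_eLpNorm'] at h1
  refine h1.congr fun r => eLpNorm_congr_ae ?_
  have e : ∀ r, ⇑(Lp.compMeasurePreserving (g r) (hg r) (hf.toLp f)) =ᵐ[volume]
      fun t => f (t + r) := fun r =>
    (Lp.coeFn_compMeasurePreserving _ (hg r)).trans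
      ((hg r).quasiMeasurePreserving.ae_eq_comp hf.coeFn_toLp)
  filter_upwards [e r, e 0] with t h1 h2
  rw [Pi.sub_apply, h1, h2, add_zero]

/-- The Steklov average of `f` over the forward interval `[t, t + h]`, meant for `h > 0`. -/
noncomputable def steklov {X : Type*} [NormedAddCommGroup X] [NormedSpace ℝ X]
    (h : ℝ) (f : ℝ → X) (t : ℝ) : X := h⁻¹ • ∫ τ in t..(t + h), f τ

theorem intervalIntegrable_of_memLp_two {X : Type*} [NormedAddCommGroup X] {f : ℝ → X}
    (hf : MemLp f 2 volume) (a b : ℝ) :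
    IntervalIntegrable f volume a b := by
  rw [intervalIntegrable_iff]
  exact (hf.locallyIntegrable (by norm_num)).integrableOn_isCompact isCompact_uIcc |>.mono_set
    uIoc_subset_uIcc

section Steklov

variable {X : Type*} [NormedAddCommGroup X] [NormedSpace ℝ X]

theorem steklov_sub_eq [CompleteSpace X] {f : ℝ → X} (hf : MemLp f 2 volume) {h : ℝ} (hh : 0 < h)
    (t : ℝ) : steklov h f t - f t
      = ∫ r, (f (t + r) - f t) ∂((ENNReal.ofReal h)⁻¹ • volume.restrict (Ioc 0 h)) := by
  have h1 : IntervalIntegrable (fun r => f (t + r)) volume 0 h := by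
    have := (intervalIntegrable_of_memLp_two hf t (t + h)).comp_add_left t
    simpa using this
  rw [integral_smul_measure, ← intervalIntegral.integral_of_le hh.le,
    intervalIntegral.integral_sub h1 (by simp), intervalIntegral.integral_comp_add_left]
  simp only [steklov, intervalIntegral.integral_const, sub_zero, ENNReal.toReal_inv,
    ENNReal.toReal_ofReal hh.le, smul_sub, add_zero]
  rw [smul_smul, inv_mul_cancel₀ hh.ne', one_smul]

/-- The error `steklov h f t - f t` is the mean of `f (t + r) - f t` over `r ∈ (0, h]`, so the bound
follows from Jensen's inequality and Tonelli's theorem. -/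
theorem eLpNorm_steklov_sub_le [CompleteSpace X] {f : ℝ → X} (hf : MemLp f 2 volume)
    {h : ℝ} (hh : 0 < h) {C : ℝ≥0∞}
    (hC : ∀ r ∈ Ioc 0 h, eLpNorm (fun t => f (t + r) - f t) 2 volume ≤ C) :
    eLpNorm (fun t => steklov h f t - f t) 2 volume ≤ C := by
  wlog hfm : StronglyMeasurable f generalizing f
  · have hae := hf.1.ae_eq_mk
    have hf' : MemLp (hf.1.mk f) 2 volume := (memLp_congr_ae hae).1 hf
    have h1 := this hf' (fun r hr => by
      refine le_of_eq_of_le (eLpNorm_congr_ae ?_) (hC r hr)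
      have := (measurePreserving_add_right volume r).quasiMeasurePreserving.ae_eq_comp hae
      filter_upwards [hae, this] with t h1 h2
      simp only [Function.comp_apply] at h2
      rw [h1, h2]) hf.1.stronglyMeasurable_mk
    refine le_of_eq_of_le (eLpNorm_congr_ae ?_) h1
    filter_upwards [hae] with t ht
    rw [ht]
    congr 1
    unfold steklov
    congr 1
    apply intervalIntegral.integral_congr_ae
    filter_upwards [hae] with τ hτ _ using hτ
  set μ : Measure ℝ := (ENNReal.ofReal h)⁻¹ • volume.restrict (Ioc 0 h) with hμ
  have hpos : ENNReal.ofReal h ≠ 0 := by simpa using hh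
  have hprob : IsProbabilityMeasure μ := ⟨by
    simp [hμ, ENNReal.inv_mul_cancel hpos ENNReal.ofReal_ne_top]⟩
  have hm : Measurable (fun z : ℝ × ℝ => ‖f (z.1 + z.2) - f z.1‖ₑ ^ (2 : ℝ)) := by
    have := (hfm.comp_measurable (measurable_fst.add measurable_snd : Measurable
      (fun z : ℝ × ℝ => z.1 + z.2))).sub (hfm.comp_measurable measurable_fst)
    exact this.enorm.pow_const _
  have hsq : ∀ F : ℝ → X, ∀ ν : Measure ℝ,
      eLpNorm F 2 ν = (∫⁻ t, ‖F t‖ₑ ^ (2 : ℝ) ∂ν) ^ (1 / 2 : ℝ) := fun F ν => by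
    rw [eLpNorm_eq_lintegral_rpow_enorm_toReal (by norm_num) (by norm_num)]; simp
  have hpt : ∀ t, ‖steklov h f t - f t‖ₑ ^ (2 : ℝ)
      ≤ ∫⁻ r, ‖f (t + r) - f t‖ₑ ^ (2 : ℝ) ∂μ := by
    intro t
    have h1 : AEStronglyMeasurable (fun r => f (t + r) - f t) μ :=
      ((hfm.comp_measurable (measurable_const_add t)).sub
        stronglyMeasurable_const).aestronglyMeasurable
    have h2 : ‖steklov h f t - f t‖ₑ ≤ eLpNorm (fun r => f (t + r) - f t) 2 μ := by
      rw [steklov_sub_eq hf hh]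
      refine (enorm_integral_le_lintegral_enorm _).trans ?_
      rw [← eLpNorm_one_eq_lintegral_enorm]
      exact eLpNorm_le_eLpNorm_of_exponent_le (by norm_num) h1
    rw [hsq] at h2
    calc _ ≤ ((∫⁻ r, ‖f (t + r) - f t‖ₑ ^ (2 : ℝ) ∂μ) ^ (1 / 2 : ℝ)) ^ (2 : ℝ) := by gcongr
      _ = _ := by rw [← ENNReal.rpow_mul]; norm_num
  have htot : ∫⁻ t, ‖steklov h f t - f t‖ₑ ^ (2 : ℝ) ≤ C ^ (2 : ℝ) := by
    calc _ ≤ ∫⁻ t, ∫⁻ r, ‖f (t + r) - f t‖ₑ ^ (2 : ℝ) ∂μ := lintegral_mono hpt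
      _ = ∫⁻ r, (∫⁻ t, ‖f (t + r) - f t‖ₑ ^ (2 : ℝ)) ∂μ :=
        lintegral_lintegral_swap hm.aemeasurable
      _ ≤ ∫⁻ _r, C ^ (2 : ℝ) ∂μ := by
        apply lintegral_mono_ae
        refine Measure.ae_smul_measure ?_ _
        refine (ae_restrict_iff' measurableSet_Ioc).2 (.of_forall fun r hr => ?_)
        have h1 := hC r hr
        rw [hsq] at h1
        calc _ = ((∫⁻ t, ‖f (t + r) - f t‖ₑ ^ (2 : ℝ)) ^ (1 / 2 : ℝ)) ^ (2 : ℝ) := by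
              rw [← ENNReal.rpow_mul]; norm_num
          _ ≤ _ := by gcongr
      _ = _ := by simp
  rw [hsq]
  calc _ ≤ (C ^ (2 : ℝ)) ^ (1 / 2 : ℝ) := by gcongr
    _ = C := by rw [← ENNReal.rpow_mul]; norm_num

theorem tendsto_eLpNorm_steklov_sub [CompleteSpace X] {f : ℝ → X} (hf : MemLp f 2 volume) :
    Tendsto (fun h : ℝ => eLpNorm (fun t => steklov h f t - f t) 2 volume) (𝓝[>] 0) (𝓝 0) := by
  rw [ENNReal.tendsto_nhds_zero]
  intro ε hε
  have h1 := ENNReal.tendsto_nhds_zero.1 (tendsto_eLpNorm_translate_sub hf) ε hε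
  obtain ⟨δ, hδ, hball⟩ := Metric.eventually_nhds_iff.1 h1
  filter_upwards [Ioo_mem_nhdsGT hδ] with h hh
  refine eLpNorm_steklov_sub_le hf hh.1 fun r hr => hball ?_
  rw [Real.dist_eq, sub_zero, abs_of_pos hr.1]
  exact hr.2.trans_lt hh.2

theorem continuous_steklov [CompleteSpace X] {f : ℝ → X} (hf : MemLp f 2 volume) (h : ℝ) :
    Continuous (steklov h f) := by
  have hc : Continuous fun b => ∫ τ in (0 : ℝ)..b, f τ :=
    intervalIntegral.continuous_primitive (intervalIntegrable_of_memLp_two hf) 0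
  have : steklov h f = fun t => h⁻¹ • ((∫ τ in (0 : ℝ)..(t + h), f τ) - ∫ τ in (0 : ℝ)..t, f τ) := by
    ext t
    rw [intervalIntegral.integral_interval_sub_left] <;>
      first | rfl | exact intervalIntegrable_of_memLp_two hf _ _
  rw [this]
  exact ((hc.comp (continuous_id.add continuous_const)).sub hc).const_smul _

theorem memLp_steklov [CompleteSpace X] {f : ℝ → X} (hf : MemLp f 2 volume) {h : ℝ}
    (hh : 0 < h) : MemLp (steklov h f) 2 volume := by
  have hle := eLpNorm_steklov_sub_le hf hh (C := eLpNorm f 2 volume + eLpNorm f 2 volume)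
    fun r _ => by
      have hr := measurePreserving_add_right (volume : Measure ℝ) r
      refine (eLpNorm_sub_le (hf.1.comp_measurePreserving hr) hf.1 (by norm_num)).trans ?_
      exact add_le_add (eLpNorm_comp_measurePreserving hf.1 hr).le le_rfl
  have : MemLp (fun t => steklov h f t - f t) 2 volume :=
    ⟨(continuous_steklov hf h).aestronglyMeasurable.sub hf.1,
      hle.trans_lt (ENNReal.add_lt_top.2 ⟨hf.2, hf.2⟩)⟩
  exact (this.add hf).congr_norm (continuous_steklov hf h).aestronglyMeasurable (by simp)

end Steklov

/-! ### The energy identity -/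

theorem tendsto_clm_apply {ι E F : Type*} [NormedAddCommGroup E] [NormedSpace ℝ E]
    [NormedAddCommGroup F] [NormedSpace ℝ F] {l : Filter ι} {A : ι → E →L[ℝ] F} {a : E →L[ℝ] F}
    {x : ι → E} {y : E} (hA : Tendsto A l (𝓝 a)) (hx : Tendsto x l (𝓝 y)) :
    Tendsto (fun i => A i (x i)) l (𝓝 (a y)) :=
  (isBoundedBilinearMap_apply.continuous.tendsto (a, y)).comp (hA.prodMk_nhds hx)

theorem memLp_indicator_timeMeasure {X : Type*} [NormedAddCommGroup X] {T : ℝ} {f : ℝ → X}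
    (hf : MemLp f 2 (timeMeasure T)) : MemLp ((Ioo 0 T).indicator f) 2 volume :=
  (memLp_indicator_iff_restrict measurableSet_Ioo).2 hf

section Pairing

variable {α V : Type*} [MeasurableSpace α] {μ : Measure α} [NormedAddCommGroup V] [NormedSpace ℝ V]

theorem integrable_apply_of_memLp_two {g : α → V →L[ℝ] ℝ} {v : α → V} (hg : MemLp g 2 μ)
    (hv : MemLp v 2 μ) : Integrable (fun t => g t (v t)) μ := by
  refine (hg.norm.integrable_mul hv.norm).mono' ?_ (.of_forall fun t => (g t).le_opNorm (v t))
  exact (ContinuousLinearMap.id ℝ (V →L[ℝ] ℝ)).aestronglyMeasurable_comp₂ hg.1 hv.1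

theorem tendsto_integral_apply_of_tendsto_eLpNorm {ι : Type*} {l : Filter ι}
    {G : ι → α → V →L[ℝ] ℝ} {g : α → V →L[ℝ] ℝ} {U : ι → α → V} {v : α → V}
    (hG : ∀ i, MemLp (G i) 2 μ) (hg : MemLp g 2 μ) (hU : ∀ i, MemLp (U i) 2 μ) (hv : MemLp v 2 μ)
    (hGg : Tendsto (fun i => eLpNorm (G i - g) 2 μ) l (𝓝 0))
    (hUv : Tendsto (fun i => eLpNorm (U i - v) 2 μ) l (𝓝 0)) :
    Tendsto (fun i => ∫ t, G i t (U i t) ∂μ) l (𝓝 (∫ t, g t (v t) ∂μ)) := by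
  obtain ⟨P, hP⟩ : ∃ P, P = (ContinuousLinearMap.id ℝ (V →L[ℝ] ℝ)).lpPairing μ 2 2 := ⟨_, rfl⟩
  have h1 := (Lp.tendsto_Lp_iff_tendsto_eLpNorm'' G hG g hg).2 hGg
  have h2 := (Lp.tendsto_Lp_iff_tendsto_eLpNorm'' U hU v hv).2 hUv
  have h3 : Tendsto (fun i => P ((hG i).toLp _)) l (𝓝 (P (hg.toLp _))) :=
    (P.continuous.tendsto _).comp h1
  have h4 : Tendsto (fun i => P ((hG i).toLp _) ((hU i).toLp _)) l
      (𝓝 (P (hg.toLp _) (hv.toLp _))) := tendsto_clm_apply h3 h2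
  have key : ∀ (G : α → V →L[ℝ] ℝ) (U : α → V) (hG : MemLp G 2 μ) (hU : MemLp U 2 μ),
      P (hG.toLp G) (hU.toLp U) = ∫ t, G t (U t) ∂μ := by
    intro G U hG hU
    rw [hP, ContinuousLinearMap.lpPairing_eq_integral]
    apply integral_congr_ae
    filter_upwards [hG.coeFn_toLp, hU.coeFn_toLp] with t h1 h2
    rw [h1, h2]; rfl
  simpa only [key] using h4

end Pairing

section EnergyIdentity

variable {V H : Type*}
  [NormedAddCommGroup V] [InnerProductSpace ℝ V] [CompleteSpace V]
  [NormedAddCommGroup H] [InnerProductSpace ℝ H] [CompleteSpace H]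

/-- The energy identity for Steklov averages: the average of `w` is continuously differentiable and
`V`-valued, so that the chain rule applies to its squared norm. -/
theorem energy_identity_steklov (j : V →L[ℝ] H) {T : ℝ} {w : ℝ → H} {v : ℝ → V}
    {g : ℝ → V →L[ℝ] ℝ} (hw : Continuous w) (hv : MemLp v 2 volume) (hg : MemLp g 2 volume)
    (hae : ∀ᵐ t, t ∈ Ioo 0 T → w t = j (v t))
    (heq : ∀ s t, 0 ≤ s → s ≤ t → t ≤ T → ∀ x, inner ℝ (w t - w s) (j x) = ∫ τ in s..t, g τ x)
    {s t h : ℝ} (hs : 0 ≤ s) (hst : s ≤ t) (hh : 0 < h) (hth : t + h ≤ T) :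
    ‖steklov h w t‖ ^ 2 - ‖steklov h w s‖ ^ 2
      = 2 * ∫ τ in s..t, steklov h g τ (steklov h v τ) := by
  have hwi : ∀ a b, IntervalIntegrable w volume a b := fun a b => hw.intervalIntegrable a b
  have hd : ∀ τ, HasDerivAt (steklov h w) (h⁻¹ • (w (τ + h) - w τ)) τ := by
    intro τ
    have h1 : ∀ τ, HasDerivAt (fun b => ∫ r in (0 : ℝ)..b, w r) (w τ) τ := fun τ =>
      intervalIntegral.integral_hasDerivAt_right (hwi 0 τ)
        (hw.stronglyMeasurableAtFilter _ _) hw.continuousAt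
    have h2 : steklov h w
        = fun t => h⁻¹ • ((∫ τ in (0 : ℝ)..(t + h), w τ) - ∫ τ in (0 : ℝ)..t, w τ) := by
      ext t
      rw [intervalIntegral.integral_interval_sub_left (hwi _ _) (hwi _ _)]
      rfl
    rw [h2]
    exact (((h1 (τ + h)).comp_add_const τ h).sub (h1 τ)).const_smul h⁻¹
  have hj : ∀ τ ∈ Icc s t, steklov h w τ = j (steklov h v τ) := by
    intro τ hτ
    unfold steklov
    rw [map_smul, ← j.intervalIntegral_comp_comm (intervalIntegrable_of_memLp_two hv _ _)]
    congr 1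
    apply intervalIntegral.integral_congr_ae
    have hne : ∀ᵐ r : ℝ, r ≠ T := by simp [ae_iff, measure_singleton]
    filter_upwards [hae, hne] with r hr hrT hrm
    rw [uIoc_of_le (by linarith)] at hrm
    exact hr ⟨by linarith [hrm.1, hτ.1], lt_of_le_of_ne (by linarith [hrm.2, hτ.2]) hrT⟩
  have hpair : ∀ τ ∈ Icc s t, 2 * inner ℝ (steklov h w τ) (h⁻¹ • (w (τ + h) - w τ))
      = 2 * steklov h g τ (steklov h v τ) := by
    intro τ hτ
    rw [real_inner_comm, inner_smul_left, hj τ hτ,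
      heq τ (τ + h) (by linarith [hτ.1]) (by linarith) (by linarith [hτ.2])]
    conv_rhs => rw [steklov]
    rw [smul_apply, ContinuousLinearMap.intervalIntegral_apply
      (intervalIntegrable_of_memLp_two hg _ _)]
    simp
  have hderiv : ∀ τ ∈ uIcc s t, HasDerivAt (fun τ => ‖steklov h w τ‖ ^ 2)
      (2 * steklov h g τ (steklov h v τ)) τ := by
    intro τ hτ
    rw [uIcc_of_le hst] at hτ
    rw [← hpair τ hτ]
    exact (hd τ).norm_sq
  rw [← intervalIntegral.integral_eq_sub_of_hasDerivAt hderiv,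
    intervalIntegral.integral_const_mul]
  exact (((continuous_steklov hg h).clm_apply (continuous_steklov hv h)).const_mul
    2).intervalIntegrable _ _

/-- The energy identity for functions continuous on the whole line, obtained from the one for Steklov
averages as their width tends to zero. -/
theorem energy_identity_of_continuous (j : V →L[ℝ] H) {T : ℝ} {w : ℝ → H} {v : ℝ → V}
    {g : ℝ → V →L[ℝ] ℝ} (hw : Continuous w) (hv : MemLp v 2 volume) (hg : MemLp g 2 volume)
    (hae : ∀ᵐ t, t ∈ Ioo 0 T → w t = j (v t))
    (heq : ∀ s t, 0 ≤ s → s ≤ t → t ≤ T → ∀ x, inner ℝ (w t - w s) (j x) = ∫ τ in s..t, g τ x)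
    {s t : ℝ} (hs : 0 ≤ s) (hst : s ≤ t) (ht : t ≤ T) :
    ‖w t‖ ^ 2 - ‖w s‖ ^ 2 = 2 * ∫ τ in s..t, g τ (v τ) := by
  have hint : ∀ a b, IntervalIntegrable (fun τ => g τ (v τ)) volume a b := fun a b =>
    (integrable_apply_of_memLp_two hg hv).intervalIntegrable
  -- first the case `t < T`, where averages over `[t, t + h]` make sense
  have hlt : ∀ t, s ≤ t → t < T → ‖w t‖ ^ 2 - ‖w s‖ ^ 2 = 2 * ∫ τ in s..t, g τ (v τ) := by
    intro t hst htT
    let h : ℕ → ℝ := fun n => (T - t) / (n + 1)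
    have hpos : ∀ n, 0 < h n := fun n => div_pos (sub_pos.2 htT) (by positivity)
    have hle : ∀ n, t + h n ≤ T := fun n => by
      have : h n ≤ T - t := div_le_self (sub_pos.2 htT).le (by simp)
      linarith
    have hlim : Tendsto h atTop (𝓝[>] 0) := by
      rw [tendsto_nhdsWithin_iff]
      refine ⟨?_, .of_forall hpos⟩
      have := (tendsto_one_div_add_atTop_nhds_zero_nat (𝕜 := ℝ)).const_mul (T - t)
      simpa [h, div_eq_mul_inv] using this
    have hw_lim : ∀ τ, Tendsto (fun n => steklov (h n) w τ) atTop (𝓝 (w τ)) := by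
      intro τ
      have h1 : HasDerivAt (fun b => ∫ r in τ..b, w r) (w τ) τ :=
        intervalIntegral.integral_hasDerivAt_right (hw.intervalIntegrable _ _)
          (hw.stronglyMeasurableAtFilter _ _) hw.continuousAt
      have h2 := (hasDerivAt_iff_tendsto_slope_zero.1 h1).comp
        (hlim.mono_right (nhdsWithin_mono 0 fun x (hx : 0 < x) => hx.ne'))
      simpa [Function.comp_def, steklov] using h2
    have hmono : ∀ {X : Type _} [NormedAddCommGroup X] [NormedSpace ℝ X] [CompleteSpace X]
        {f : ℝ → X}, MemLp f 2 volume →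
        Tendsto (fun n => eLpNorm (steklov (h n) f - f) 2 (volume.restrict (Ioc s t)))
          atTop (𝓝 0) := by
      intro X _ _ _ f hf
      refine tendsto_of_tendsto_of_tendsto_of_le_of_le tendsto_const_nhds
        ((tendsto_eLpNorm_steklov_sub hf).comp hlim) (fun _ => bot_le) fun n => ?_
      exact eLpNorm_mono_measure _ Measure.restrict_le_self
    have hR := tendsto_integral_apply_of_tendsto_eLpNorm (μ := volume.restrict (Ioc s t))
      (fun n => (memLp_steklov hg (hpos n)).restrict _) (hg.restrict _)
      (fun n => (memLp_steklov hv (hpos n)).restrict _) (hv.restrict _) (hmono hg) (hmono hv)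
    have hL : Tendsto (fun n => ‖steklov (h n) w t‖ ^ 2 - ‖steklov (h n) w s‖ ^ 2) atTop
        (𝓝 (‖w t‖ ^ 2 - ‖w s‖ ^ 2)) :=
      ((hw_lim t).norm.pow 2).sub ((hw_lim s).norm.pow 2)
    rw [intervalIntegral.integral_of_le hst]
    refine tendsto_nhds_unique hL ((hR.const_mul 2).congr fun n => ?_)
    rw [energy_identity_steklov j hw hv hg hae heq hs hst (hpos n) (hle n),
      intervalIntegral.integral_of_le hst]
  rcases ht.lt_or_eq with h | rfl
  · exact hlt t hst h
  rcases hst.eq_or_lt with rfl | hst'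
  · simp
  have hc1 : Continuous fun b => ‖w b‖ ^ 2 - ‖w s‖ ^ 2 := by fun_prop
  have hc2 : Continuous fun b => 2 * ∫ τ in s..b, g τ (v τ) :=
    (intervalIntegral.continuous_primitive hint s).const_mul 2
  have hne : (𝓝[<] t).NeBot := inferInstance
  refine tendsto_nhds_unique (f := fun b => ‖w b‖ ^ 2 - ‖w s‖ ^ 2) (l := 𝓝[<] t)
    ((hc1.tendsto t).mono_left nhdsWithin_le_nhds)
    (((hc2.tendsto t).mono_left nhdsWithin_le_nhds).congr' ?_)
  filter_upwards [Ioo_mem_nhdsLT hst'] with b hb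
  exact (hlt b hb.1.le hb.2).symm

/-- `w` is continuous on `[0, T]` with values in `H`, belongs to `L²(0, T; V)` through the
representative `v`, and has the derivative `g ∈ L²(0, T; V*)` in the integrated sense. -/
structure IsEvolution (j : V →L[ℝ] H) (T : ℝ) (g : ℝ → V →L[ℝ] ℝ) (w : ℝ → H) (v : ℝ → V) :
    Prop where
  cont : ContinuousOn w (Icc 0 T)
  memLp_v : MemLp v 2 (timeMeasure T)
  memLp_g : MemLp g 2 (timeMeasure T)
  ae_eq : ∀ᵐ t ∂(timeMeasure T), w t = j (v t)
  inner_eq : ∀ t ∈ Icc 0 T, ∀ x, inner ℝ (w t - w 0) (j x) = ∫ τ in (0 : ℝ)..t, g τ x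

theorem intervalIntegrable_of_integrable_timeMeasure {E : Type*} [NormedAddCommGroup E]
    {T : ℝ} {f : ℝ → E} (hf : Integrable f (timeMeasure T)) {s t : ℝ} (hs : s ∈ Icc 0 T)
    (ht : t ∈ Icc 0 T) : IntervalIntegrable f volume s t := by
  have hT : 0 ≤ T := hs.1.trans hs.2
  have h0 : IntervalIntegrable f volume 0 T := by
    rwa [intervalIntegrable_iff_integrableOn_Ioo_of_le hT]
  apply h0.mono_set
  rw [uIcc_of_le hT]
  exact ordConnected_Icc.uIcc_subset hs ht

omit [CompleteSpace V] in
theorem integrable_apply_const_of_memLp_two {T : ℝ} {g : ℝ → V →L[ℝ] ℝ}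
    (hg : MemLp g 2 (timeMeasure T)) (x : V) : Integrable (fun t => g t x) (timeMeasure T) :=
  integrable_apply_of_memLp_two hg (memLp_const x)

namespace IsEvolution

variable {j : V →L[ℝ] H} {T : ℝ} {g : ℝ → V →L[ℝ] ℝ} {w : ℝ → H} {v : ℝ → V}

omit [CompleteSpace V] [CompleteSpace H] in
theorem inner_sub_eq (hE : IsEvolution j T g w v) {s t : ℝ} (hs : s ∈ Icc 0 T) (ht : t ∈ Icc 0 T)
    (x : V) : inner ℝ (w t - w s) (j x) = ∫ τ in s..t, g τ x := by
  have h0 : (0 : ℝ) ∈ Icc 0 T := ⟨le_rfl, hs.1.trans hs.2⟩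
  have hi := integrable_apply_const_of_memLp_two hE.memLp_g x
  rw [← intervalIntegral.integral_interval_sub_left
    (intervalIntegrable_of_integrable_timeMeasure hi h0 ht)
    (intervalIntegrable_of_integrable_timeMeasure hi h0 hs), ← hE.inner_eq t ht x,
    ← hE.inner_eq s hs x, ← inner_sub_left]
  congr 1; abel

/-- The energy identity `‖w(t)‖² - ‖w(s)‖² = 2 ∫ₛᵗ ⟨w', w⟩`. -/
theorem energy_identity (hE : IsEvolution j T g w v) {s t : ℝ} (hs : 0 ≤ s) (hst : s ≤ t)
    (ht : t ≤ T) : ‖w t‖ ^ 2 - ‖w s‖ ^ 2 = 2 * ∫ τ in s..t, g τ (v τ) := by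
  have hT : 0 ≤ T := hs.trans (hst.trans ht)
  have hproj : ∀ t, max 0 (min t T) ∈ Icc 0 T := fun t =>
    ⟨le_max_left _ _, max_le hT (min_le_right _ _)⟩
  have hid : ∀ t ∈ Icc 0 T, max 0 (min t T) = t := fun t ht => by
    rw [min_eq_left ht.2, max_eq_right ht.1]
  have hne : ∀ᵐ r : ℝ, r ≠ T := by simp [ae_iff, measure_singleton]
  have hW : Continuous fun t => w (max 0 (min t T)) :=
    hE.cont.comp_continuous (by fun_prop) hproj
  have key := energy_identity_of_continuous j (T := T) (w := fun t => w (max 0 (min t T)))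
    (v := (Ioo 0 T).indicator v) (g := (Ioo 0 T).indicator g) hW
    (memLp_indicator_timeMeasure hE.memLp_v)
    (memLp_indicator_timeMeasure hE.memLp_g)
    (by
      have := (ae_restrict_iff' measurableSet_Ioo).1 hE.ae_eq
      filter_upwards [this] with t ht htm
      rw [hid t (Ioo_subset_Icc_self htm), indicator_of_mem htm, ht htm])
    (by
      intro s t hs hst ht x
      rw [hid s ⟨hs, hst.trans ht⟩, hid t ⟨hs.trans hst, ht⟩,
        hE.inner_sub_eq ⟨hs, hst.trans ht⟩ ⟨hs.trans hst, ht⟩]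
      apply intervalIntegral.integral_congr_ae
      filter_upwards [hne] with r hr hrm
      rw [uIoc_of_le hst] at hrm
      rw [indicator_of_mem]
      exact ⟨hs.trans_lt hrm.1, lt_of_le_of_ne (hrm.2.trans ht) hr⟩)
    hs hst ht
  simp only [hid s ⟨hs, hst.trans ht⟩, hid t ⟨hs.trans hst, ht⟩] at key
  rw [key]
  congr 1
  apply intervalIntegral.integral_congr_ae
  filter_upwards [hne] with r hr hrm
  rw [uIoc_of_le hst] at hrm
  have : r ∈ Ioo 0 T := ⟨hs.trans_lt hrm.1, lt_of_le_of_ne (hrm.2.trans ht) hr⟩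
  rw [indicator_of_mem this, indicator_of_mem this]

end IsEvolution

end EnergyIdentity

/-! ### Solutions and the a priori estimate -/

section SquareIntegrals

variable {α X : Type*} [MeasurableSpace α] {μ : Measure α} [NormedAddCommGroup X]

theorem integrable_norm_sq_of_memLp_two {f : α → X} (hf : MemLp f 2 μ) :
    Integrable (fun t => ‖f t‖ ^ 2) μ := hf.integrable_norm_pow (by norm_num)

theorem integral_norm_sq_eq {f : α → X} (hf : MemLp f 2 μ) :
    ∫ t, ‖f t‖ ^ 2 ∂μ = (eLpNorm f 2 μ).toReal ^ 2 := by
  have h0 : 0 ≤ ∫ t, ‖f t‖ ^ 2 ∂μ := integral_nonneg fun _ => by positivity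
  rw [hf.eLpNorm_eq_integral_rpow_norm (by norm_num) (by norm_num)]
  simp only [ENNReal.toReal_ofNat, Real.rpow_ofNat]
  rw [ENNReal.toReal_ofReal (by positivity), ← Real.rpow_natCast, ← Real.rpow_mul h0]
  norm_num

theorem integral_norm_sq_toLp_sub {f g : α → X} (hf : MemLp f 2 μ) (hg : MemLp g 2 μ) :
    ∫ t, ‖f t - g t‖ ^ 2 ∂μ = ‖hf.toLp f - hg.toLp g‖ ^ 2 := by
  rw [← MemLp.toLp_sub, Lp.norm_toLp, ← integral_norm_sq_eq (hf.sub hg)]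
  rfl

end SquareIntegrals

/-- Grönwall's inequality in integral form. -/
theorem gronwall_integral {E : ℝ → ℝ} {T K c : ℝ} (hc : 0 ≤ c)
    (hE : ContinuousOn E (Icc 0 T))
    (h : ∀ t ∈ Icc 0 T, E t ≤ K + c * ∫ τ in (0 : ℝ)..t, E τ) :
    ∀ t ∈ Icc 0 T, E t ≤ K * Real.exp (c * t) := by
  intro t ht
  have hT : 0 ≤ T := ht.1.trans ht.2
  set ψ : ℝ → ℝ := fun t => (K + c * ∫ τ in (0 : ℝ)..t, E τ) * Real.exp (-(c * t)) with hψ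
  have hcont : ContinuousOn (fun t => ∫ τ in (0 : ℝ)..t, E τ) (Icc 0 T) := by
    have := intervalIntegral.continuousOn_primitive_interval (μ := volume) (f := E) (a := 0) (b := T)
      (by rw [uIcc_of_le hT]; exact hE.integrableOn_Icc)
    rwa [uIcc_of_le hT] at this
  have hanti : AntitoneOn ψ (Icc 0 T) := by
    have hd : ∀ t ∈ Ioo 0 T, HasDerivAt ψ (c * (E t - (K + c * ∫ τ in (0 : ℝ)..t, E τ))
        * Real.exp (-(c * t))) t := by
      intro t ht
      have h1 : HasDerivAt (fun t => ∫ τ in (0 : ℝ)..t, E τ) (E t) t := by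
        refine intervalIntegral.integral_hasDerivAt_right ?_ ?_
          (hE.continuousAt (Icc_mem_nhds ht.1 ht.2))
        · exact (hE.mono (Icc_subset_Icc_right ht.2.le)).intervalIntegrable_of_Icc ht.1.le
        · exact (hE.mono Ioo_subset_Icc_self).stronglyMeasurableAtFilter isOpen_Ioo t ht
      have h2 : HasDerivAt (fun t => Real.exp (-(c * t))) (Real.exp (-(c * t)) * (-(c * 1))) t :=
        (((hasDerivAt_id t).const_mul c).neg).exp
      convert! ((h1.const_mul c).const_add K).mul h2 using 1
      ring
    refine antitoneOn_of_deriv_nonpos (convex_Icc 0 T) ?_ ?_ ?_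
    · exact (continuousOn_const.add (continuousOn_const.mul hcont)).mul
        (by fun_prop : Continuous fun t => Real.exp (-(c * t))).continuousOn
    · rw [interior_Icc]
      exact fun t ht => (hd t ht).differentiableAt.differentiableWithinAt
    · rw [interior_Icc]
      intro t ht
      rw [(hd t ht).deriv]
      have := h t (Ioo_subset_Icc_self ht)
      exact mul_nonpos_of_nonpos_of_nonneg
        (mul_nonpos_of_nonneg_of_nonpos hc (by linarith)) (Real.exp_pos _).le
  have h1 : ψ t ≤ ψ 0 := hanti ⟨le_rfl, hT⟩ ht ht.1
  simp only [hψ, intervalIntegral.integral_same, mul_zero, add_zero, neg_zero, Real.exp_zero,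
    mul_one] at h1
  rw [Real.exp_neg, ← div_eq_mul_inv, div_le_iff₀ (Real.exp_pos _)] at h1
  exact (h t ht).trans h1

theorem intervalIntegral_eq_timeMeasure {X : Type*} [NormedAddCommGroup X] [NormedSpace ℝ X]
    {T : ℝ} (hT : 0 ≤ T) (f : ℝ → X) : ∫ t in (0 : ℝ)..T, f t = ∫ t, f t ∂(timeMeasure T) := by
  rw [intervalIntegral.integral_of_le hT, integral_Ioc_eq_integral_Ioo]

theorem timeMeasure_mono {s T : ℝ} (h : s ≤ T) : timeMeasure s ≤ timeMeasure T :=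
  Measure.restrict_mono (Ioo_subset_Ioo_right h) le_rfl

namespace ControlSystem

variable {V H Ω : Type*}
  [NormedAddCommGroup V] [InnerProductSpace ℝ V] [CompleteSpace V]
  [NormedAddCommGroup H] [InnerProductSpace ℝ H] [CompleteSpace H]
  [MeasurableSpace Ω] {ρ : Measure Ω} (S : ControlSystem V H ρ)

/-- `w` solves `∂ₜ w + A w = f` on `(0, T)` in the integrated sense, with an arbitrary initial
value; `v` is `w` regarded as an element of `L²(0, T; V)`. -/
structure IsSolution (T : ℝ) (f : ℝ → V →L[ℝ] ℝ) (w : ℝ → H) (v : ℝ → V) : Prop where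
  memLp_f : MemLp f 2 (timeMeasure T)
  evol : IsEvolution S.j T (fun t => f t - S.a (v t)) w v

variable {S}

theorem memLp_a_comp {α : Type*} [MeasurableSpace α] {μ : Measure α} {v : α → V}
    (hv : MemLp v 2 μ) : MemLp (fun t => S.a (v t)) 2 μ := S.a.comp_memLp' hv

namespace IsSolution

variable {T : ℝ} {f f₁ f₂ : ℝ → V →L[ℝ] ℝ} {w w₁ w₂ : ℝ → H} {v v₁ v₂ : ℝ → V}

theorem mono (h : S.IsSolution T f w v) {s : ℝ} (hs : s ≤ T) : S.IsSolution s f w v where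
  memLp_f := h.memLp_f.mono_measure (timeMeasure_mono hs)
  evol :=
    { cont := h.evol.cont.mono (Icc_subset_Icc_right hs)
      memLp_v := h.evol.memLp_v.mono_measure (timeMeasure_mono hs)
      memLp_g := h.evol.memLp_g.mono_measure (timeMeasure_mono hs)
      ae_eq := ae_mono (timeMeasure_mono hs) h.evol.ae_eq
      inner_eq := fun t ht => h.evol.inner_eq t ⟨ht.1, ht.2.trans hs⟩ }

theorem congr_ae (h : S.IsSolution T f₁ w v) (hf : f₁ =ᵐ[timeMeasure T] f₂) :
    S.IsSolution T f₂ w v where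
  memLp_f := (memLp_congr_ae hf).1 h.memLp_f
  evol :=
    { cont := h.evol.cont
      memLp_v := h.evol.memLp_v
      memLp_g := ((memLp_congr_ae hf).1 h.memLp_f).sub (memLp_a_comp h.evol.memLp_v)
      ae_eq := h.evol.ae_eq
      inner_eq := fun t ht x => by
        rw [h.evol.inner_eq t ht, intervalIntegral_eq_timeMeasure ht.1,
          intervalIntegral_eq_timeMeasure ht.1]
        apply integral_congr_ae
        filter_upwards [ae_mono (timeMeasure_mono ht.2) hf] with τ hτ
        rw [hτ] }

theorem linearComb (h₁ : S.IsSolution T f₁ w₁ v₁) (h₂ : S.IsSolution T f₂ w₂ v₂) (a b : ℝ) :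
    S.IsSolution T (fun t => a • f₁ t + b • f₂ t) (fun t => a • w₁ t + b • w₂ t)
      (fun t => a • v₁ t + b • v₂ t) := by
  have hf := (h₁.memLp_f.const_smul a).add (h₂.memLp_f.const_smul b)
  have hv := (h₁.evol.memLp_v.const_smul a).add (h₂.evol.memLp_v.const_smul b)
  refine ⟨hf, ?_, hv, hf.sub (memLp_a_comp hv), ?_, ?_⟩
  · exact (h₁.evol.cont.const_smul a).add (h₂.evol.cont.const_smul b)
  · filter_upwards [h₁.evol.ae_eq, h₂.evol.ae_eq] with t h1 h2
    rw [h1, h2]; simp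
  · intro t ht x
    have h0 : (0 : ℝ) ∈ Icc 0 T := ⟨le_rfl, ht.1.trans ht.2⟩
    have e : a • w₁ t + b • w₂ t - (a • w₁ 0 + b • w₂ 0)
        = a • (w₁ t - w₁ 0) + b • (w₂ t - w₂ 0) := by
      simp only [smul_sub]; abel
    rw [e, inner_add_left, inner_smul_left, inner_smul_left, h₁.evol.inner_eq t ht,
      h₂.evol.inner_eq t ht]
    simp only [conj_trivial]
    rw [← intervalIntegral.integral_const_mul, ← intervalIntegral.integral_const_mul,
      ← intervalIntegral.integral_add]
    · congr 1
      ext τ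
      simp only [sub_apply, map_add, map_smul, add_apply, smul_apply, smul_eq_mul]
      ring
    · exact (intervalIntegrable_of_integrable_timeMeasure
        (integrable_apply_const_of_memLp_two h₁.evol.memLp_g x) h0 ht).const_mul a
    · exact (intervalIntegrable_of_integrable_timeMeasure
        (integrable_apply_const_of_memLp_two h₂.evol.memLp_g x) h0 ht).const_mul b

theorem sub (h₁ : S.IsSolution T f₁ w₁ v₁) (h₂ : S.IsSolution T f₂ w₂ v₂) :
    S.IsSolution T (fun t => f₁ t - f₂ t) (fun t => w₁ t - w₂ t) (fun t => v₁ t - v₂ t) := by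
  have e : (fun t => f₁ t - f₂ t) = fun t => (1 : ℝ) • f₁ t + (-1 : ℝ) • f₂ t := by
    ext t x; simp [sub_eq_add_neg]
  rw [e]
  simpa [sub_eq_add_neg] using h₁.linearComb h₂ 1 (-1)

/-- The energy identity combined with the Gårding inequality. -/
theorem energy_le (h : S.IsSolution T f w v) {α₀ ω₀ : ℝ} (hα : 0 < α₀)
    (hG : ∀ v : V, α₀ * ‖v‖ ^ 2 ≤ S.a v v + ω₀ * ‖S.j v‖ ^ 2) {t : ℝ} (ht : t ∈ Icc 0 T) :
    ‖w t‖ ^ 2 + α₀ * ∫ τ, ‖v τ‖ ^ 2 ∂(timeMeasure t)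
      ≤ ‖w 0‖ ^ 2 + α₀⁻¹ * (∫ τ, ‖f τ‖ ^ 2 ∂(timeMeasure t))
        + 2 * ω₀ * ∫ τ in (0 : ℝ)..t, ‖w τ‖ ^ 2 := by
  have h' := h.mono ht.2
  have key := h.evol.energy_identity le_rfl ht.1 ht.2
  have hi1 := integrable_norm_sq_of_memLp_two h'.evol.memLp_v
  have hi2 := integrable_norm_sq_of_memLp_two h'.memLp_f
  have hi3 : Integrable (fun τ => ‖w τ‖ ^ 2) (timeMeasure t) :=
    ((h'.evol.cont.norm.pow 2).integrableOn_Icc).mono_set Ioo_subset_Icc_self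
  have hi4 := integrable_apply_of_memLp_two h'.evol.memLp_g h'.evol.memLp_v
  rw [intervalIntegral_eq_timeMeasure ht.1, ← integral_const_mul] at key
  rw [intervalIntegral_eq_timeMeasure ht.1, ← integral_const_mul, ← integral_const_mul,
    ← integral_const_mul]
  have hle : ∫ τ, 2 * (f τ - S.a (v τ)) (v τ) ∂(timeMeasure t)
      ≤ ∫ τ, (α₀⁻¹ * ‖f τ‖ ^ 2 + 2 * ω₀ * ‖w τ‖ ^ 2 - α₀ * ‖v τ‖ ^ 2) ∂(timeMeasure t) := by
    refine integral_mono_ae (hi4.const_mul 2)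
      (((hi2.const_mul _).add (hi3.const_mul _)).sub (hi1.const_mul _)) ?_
    filter_upwards [h'.evol.ae_eq] with τ hτ
    have h1 := hG (v τ)
    have h2 : f τ (v τ) ≤ ‖f τ‖ * ‖v τ‖ := (le_abs_self _).trans ((f τ).le_opNorm _)
    -- Young's inequality absorbs the source term into the coercivity of `a`
    have h3 : 2 * (‖f τ‖ * ‖v τ‖) ≤ α₀⁻¹ * ‖f τ‖ ^ 2 + α₀ * ‖v τ‖ ^ 2 := by
      have := mul_nonneg (inv_nonneg.2 hα.le) (sq_nonneg (‖f τ‖ - α₀ * ‖v τ‖))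
      have e : α₀⁻¹ * (‖f τ‖ - α₀ * ‖v τ‖) ^ 2
          = α₀⁻¹ * ‖f τ‖ ^ 2 + α₀ * ‖v τ‖ ^ 2 - 2 * (‖f τ‖ * ‖v τ‖) := by
        field_simp; ring
      linarith
    rw [← hτ] at h1
    simp only [sub_apply]
    linarith
  have hi23 : Integrable (fun τ => α₀⁻¹ * ‖f τ‖ ^ 2 + 2 * ω₀ * ‖w τ‖ ^ 2) (timeMeasure t) :=
    (hi2.const_mul _).add (hi3.const_mul _)
  rw [integral_sub hi23 (hi1.const_mul _),
    integral_add (hi2.const_mul _) (hi3.const_mul _)] at hle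
  linarith

end IsSolution

variable (S) in
/-- The a priori estimate in `C([0, T]; H) ∩ L²(0, T; V)`, uniformly for bounded `T`. -/
theorem exists_energy_bound (T₁ : ℝ) : ∃ C : ℝ, 0 ≤ C ∧ ∀ T ∈ Icc 0 T₁,
    ∀ (f : ℝ → V →L[ℝ] ℝ) (w : ℝ → H) (v : ℝ → V), S.IsSolution T f w v →
      (∀ t ∈ Icc 0 T, ‖w t‖ ^ 2 ≤ C * (‖w 0‖ ^ 2 + ∫ τ, ‖f τ‖ ^ 2 ∂(timeMeasure T))) ∧
      ∫ τ, ‖v τ‖ ^ 2 ∂(timeMeasure T)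
        ≤ C * (‖w 0‖ ^ 2 + ∫ τ, ‖f τ‖ ^ 2 ∂(timeMeasure T)) := by
  obtain ⟨α₀, hα, ω₀, hω, hG⟩ := S.garding
  set M := Real.exp (2 * ω₀ * T₁) with hM
  set C₁ := (1 + α₀⁻¹) * M with hC₁
  have hM0 : 0 < M := Real.exp_pos _
  have hC₁0 : 0 < C₁ := by positivity
  refine ⟨C₁ + α₀⁻¹ * ((1 + α₀⁻¹) + 2 * ω₀ * (|T₁| * C₁)), by positivity, ?_⟩
  intro T hT f w v h
  set F := ∫ τ, ‖f τ‖ ^ 2 ∂(timeMeasure T) with hF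
  have hF0 : 0 ≤ F := integral_nonneg fun _ => by positivity
  set D := ‖w 0‖ ^ 2 + F with hD
  have hD0 : 0 ≤ D := by positivity
  set K := ‖w 0‖ ^ 2 + α₀⁻¹ * F with hK
  have hKD : K ≤ (1 + α₀⁻¹) * D := by
    have h1 : 0 ≤ α₀⁻¹ * ‖w 0‖ ^ 2 := by positivity
    rw [hK, hD]; nlinarith
  have hK0 : 0 ≤ K := by positivity
  have hstep : ∀ t ∈ Icc 0 T, ‖w t‖ ^ 2 + α₀ * ∫ τ, ‖v τ‖ ^ 2 ∂(timeMeasure t)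
      ≤ K + 2 * ω₀ * ∫ τ in (0 : ℝ)..t, ‖w τ‖ ^ 2 := by
    intro t ht
    refine (h.energy_le hα hG ht).trans ?_
    have : ∫ τ, ‖f τ‖ ^ 2 ∂(timeMeasure t) ≤ F :=
      integral_mono_measure (timeMeasure_mono ht.2) (.of_forall fun _ => by positivity)
        (integrable_norm_sq_of_memLp_two h.memLp_f)
    rw [hK]
    gcongr
  have hw2 : ContinuousOn (fun t => ‖w t‖ ^ 2) (Icc 0 T) := h.evol.cont.norm.pow 2
  have hgr := gronwall_integral (K := K) (c := 2 * ω₀) (by positivity) hw2 fun t ht => by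
    have h1 := hstep t ht
    have h2 : 0 ≤ α₀ * ∫ τ, ‖v τ‖ ^ 2 ∂(timeMeasure t) :=
      mul_nonneg hα.le (integral_nonneg fun _ => by positivity)
    linarith
  have hw : ∀ t ∈ Icc 0 T, ‖w t‖ ^ 2 ≤ C₁ * D := by
    intro t ht
    refine (hgr t ht).trans ?_
    calc K * Real.exp (2 * ω₀ * t) ≤ ((1 + α₀⁻¹) * D) * M := by
          have : Real.exp (2 * ω₀ * t) ≤ M :=
            Real.exp_le_exp.2 (mul_le_mul_of_nonneg_left (ht.2.trans hT.2) (by positivity))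
          gcongr
      _ = C₁ * D := by rw [hC₁]; ring
  have hT' : T ∈ Icc 0 T := ⟨hT.1, le_rfl⟩
  have hint : ∫ τ in (0 : ℝ)..T, ‖w τ‖ ^ 2 ≤ |T₁| * (C₁ * D) := by
    calc _ ≤ ∫ _τ in (0 : ℝ)..T, C₁ * D :=
          intervalIntegral.integral_mono_on hT.1 (hw2.intervalIntegrable_of_Icc hT.1)
            (by simp) hw
      _ = T * (C₁ * D) := by rw [intervalIntegral.integral_const, sub_zero, smul_eq_mul]
      _ ≤ _ := by
          have := hT.2.trans (le_abs_self T₁)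
          gcongr
  have hv : ∫ τ, ‖v τ‖ ^ 2 ∂(timeMeasure T)
      ≤ α₀⁻¹ * ((1 + α₀⁻¹) + 2 * ω₀ * (|T₁| * C₁)) * D := by
    have h1 := hstep T hT'
    have h2 : α₀ * ∫ τ, ‖v τ‖ ^ 2 ∂(timeMeasure T)
        ≤ ((1 + α₀⁻¹) + 2 * ω₀ * (|T₁| * C₁)) * D := by
      have h3 : 2 * ω₀ * ∫ τ in (0 : ℝ)..T, ‖w τ‖ ^ 2 ≤ 2 * ω₀ * (|T₁| * (C₁ * D)) := by gcongr
      have h4 : 0 ≤ ‖w T‖ ^ 2 := by positivity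
      linarith
    rw [mul_assoc, ← div_eq_inv_mul, le_div_iff₀ hα]
    linarith
  have hpos : 0 ≤ α₀⁻¹ * ((1 + α₀⁻¹) + 2 * ω₀ * (|T₁| * C₁)) := by positivity
  constructor
  · intro t ht
    refine (hw t ht).trans ?_
    gcongr
    linarith
  · refine hv.trans ?_
    gcongr
    linarith

end ControlSystem

/-! ### States as solutions, stopping, uniqueness and Hölder bounds -/

theorem integrable_smul_of_hasCompactSupport {E : Type*} [NormedAddCommGroup E] [NormedSpace ℝ E]
    {μ : Measure ℝ} {ψ : ℝ → ℝ} {F : ℝ → E} (hψ : Continuous ψ) (hc : HasCompactSupport ψ)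
    (hF : Integrable F μ) : Integrable (fun t => ψ t • F t) μ := by
  obtain ⟨C, hC⟩ := hc.exists_bound_of_continuous hψ
  exact hF.bdd_smul C hψ.aestronglyMeasurable (.of_forall hC)

namespace ControlSystem

variable {V H Ω : Type*}
  [NormedAddCommGroup V] [InnerProductSpace ℝ V] [CompleteSpace V]
  [NormedAddCommGroup H] [InnerProductSpace ℝ H] [CompleteSpace H]
  [MeasurableSpace Ω] {ρ : Measure Ω} (S : ControlSystem V H ρ)

/-- The embedding `V ↪ H ↪ V*` as a continuous linear map; by definition
`S.embDual v = S.toDual (S.j v)`. -/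
noncomputable def embDual : V →L[ℝ] V →L[ℝ] ℝ :=
  ((ContinuousLinearMap.compL ℝ V H ℝ).flip S.j).comp ((innerSL ℝ).comp S.j)

variable {S}

/-- The weak formulation in `V*` is equivalent to the integrated equation tested with the elements
of `V`. -/
theorem isWeakTimeDeriv_iff {T : ℝ} (hT : 0 < T) {y : ℝ → H} {v : ℝ → V} {g : ℝ → V →L[ℝ] ℝ}
    (hy : ContinuousOn y (Icc 0 T)) (hv : MemLp v 2 (timeMeasure T))
    (hg : MemLp g 2 (timeMeasure T)) (hae : ∀ᵐ t ∂(timeMeasure T), y t = S.j (v t)) :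
    IsWeakTimeDeriv T (fun t => S.toDual (S.j (v t))) g ↔
      ∀ t ∈ Icc 0 T, ∀ x, inner ℝ (y t - y 0) (S.j x) = ∫ τ in (0 : ℝ)..t, g τ x := by
  have hgi : Integrable g (timeMeasure T) := hg.integrable (by norm_num)
  have hvi : Integrable (fun t => S.toDual (S.j (v t))) (timeMeasure T) :=
    (S.embDual.comp_memLp' hv).integrable (by norm_num)
  have hd : ∀ φ : ℝ → ℝ, ContDiff ℝ ∞ φ → Continuous (deriv φ) := fun φ hφ =>
    (contDiff_infty_iff_deriv.1 hφ).2.continuous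
  have hscalar : ∀ x : V,
      (∀ t ∈ Icc 0 T, inner ℝ (y t - y 0) (S.j x) = ∫ τ in (0 : ℝ)..t, g τ x) ↔
      ∀ φ : ℝ → ℝ, ContDiff ℝ ∞ φ → HasCompactSupport φ → tsupport φ ⊆ Ioo 0 T →
        ∫ t in Ioo 0 T, deriv φ t * inner ℝ (y t) (S.j x)
          = - ∫ t in Ioo 0 T, φ t * g t x := by
    intro x
    rw [← sub_eq_integral_iff_weakDeriv hT (hy.inner continuousOn_const)
      (integrable_apply_const_of_memLp_two hg x)]
    simp only [inner_sub_left]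
  have hlhs : ∀ (φ : ℝ → ℝ) (x : V), ContDiff ℝ ∞ φ → HasCompactSupport φ →
      (∫ t in Ioo 0 T, deriv φ t • S.toDual (S.j (v t))) x
        = ∫ t in Ioo 0 T, deriv φ t * inner ℝ (y t) (S.j x) := by
    intro φ x h1 h2
    rw [ContinuousLinearMap.integral_apply
      (integrable_smul_of_hasCompactSupport (hd φ h1) h2.deriv hvi)]
    apply integral_congr_ae
    filter_upwards [hae] with t ht
    rw [ht]; rfl
  have hrhs : ∀ (φ : ℝ → ℝ) (x : V), ContDiff ℝ ∞ φ → HasCompactSupport φ →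
      (- ∫ t in Ioo 0 T, φ t • g t) x = - ∫ t in Ioo 0 T, φ t * g t x := by
    intro φ x h1 h2
    rw [neg_apply, ContinuousLinearMap.integral_apply
      (integrable_smul_of_hasCompactSupport h1.continuous h2 hgi)]
    rfl
  constructor
  · intro h t ht x
    refine (hscalar x).2 (fun φ h1 h2 h3 => ?_) t ht
    rw [← hlhs φ x h1 h2, h φ h1 h2 h3, hrhs φ x h1 h2]
  · intro h φ h1 h2 h3
    ext x
    rw [hlhs φ x h1 h2, hrhs φ x h1 h2]
    exact (hscalar x).1 (fun t ht => h t ht x) φ h1 h2 h3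

theorem memLp_B_comp {α : Type*} [MeasurableSpace α] {μ : Measure α} {u : α → Lp ℝ 2 ρ}
    (hu : MemLp u 2 μ) : MemLp (fun t => S.B (u t)) 2 μ := S.B.comp_memLp' hu

theorem IsState.exists_isSolution {T : ℝ} (hT : 0 < T) {u : Control ρ T} {y : ℝ → H}
    (h : S.IsState T u y) : ∃ v, S.IsSolution T (fun t => S.B (u t)) y v := by
  obtain ⟨hc, -, v, hae, hw⟩ := h
  have hB := memLp_B_comp (S := S) (Lp.memLp u)
  have hg := hB.sub (memLp_a_comp (S := S) (Lp.memLp v))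
  exact ⟨v, hB, hc, Lp.memLp v, hg, hae, (isWeakTimeDeriv_iff hT hc (Lp.memLp v) hg hae).1 hw⟩

theorem IsSolution.isState {T : ℝ} (hT : 0 < T) {u : Control ρ T} {y : ℝ → H} {v : ℝ → V}
    (h : S.IsSolution T (fun t => S.B (u t)) y v) (h0 : y 0 = S.y₀) : S.IsState T u y := by
  have hv := h.evol.memLp_v
  have hae : ∀ᵐ t ∂(timeMeasure T), y t = S.j (hv.toLp v t) := by
    filter_upwards [h.evol.ae_eq, hv.coeFn_toLp] with t h1 h2
    rw [h1, h2]
  have hg := h.memLp_f.sub (memLp_a_comp (S := S) (Lp.memLp (hv.toLp v)))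
  refine ⟨h.evol.cont, h0, hv.toLp v, hae, ?_⟩
  refine (isWeakTimeDeriv_iff hT h.evol.cont (Lp.memLp _) hg hae).2 fun t ht x => ?_
  rw [h.evol.inner_eq t ht, intervalIntegral_eq_timeMeasure ht.1,
    intervalIntegral_eq_timeMeasure ht.1]
  apply integral_congr_ae
  filter_upwards [ae_mono (timeMeasure_mono ht.2) hv.coeFn_toLp] with τ hτ
  simp only [Pi.sub_apply, hτ]

/-- A square-integrable function with values in `U_ad` whose state ends in the target set is a
feasible control. -/
theorem exists_isFeasible_of_isSolution {δ T : ℝ} (hT : 0 < T) {u : ℝ → Lp ℝ 2 ρ} {y : ℝ → H}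
    {v : ℝ → V} (hu : MemLp u 2 (timeMeasure T)) (had : ∀ᵐ t ∂(timeMeasure T), u t ∈ S.Uad)
    (h : S.IsSolution T (fun t => S.B (u t)) y v) (h0 : y 0 = S.y₀)
    (hend : ‖y T - S.yd‖ ≤ S.δ₀ + δ) :
    S.IsFeasible δ T (hu.toLp u) := by
  refine ⟨hT, ?_, y, IsSolution.isState (v := v) hT (h.congr_ae ?_) h0, hend⟩
  · show ∀ᵐ t ∂(timeMeasure T), hu.toLp u t ∈ S.Uad
    filter_upwards [hu.coeFn_toLp, had] with t h1 h2
    rwa [h1]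
  · filter_upwards [hu.coeFn_toLp] with t h1
    rw [h1]

/-- An admissible trajectory can be stopped at any earlier time at which it has reached the
target set. -/
theorem exists_isFeasible_of_stop {δ T T' : ℝ} {u : Control ρ T} {y : ℝ → H} (hu : u ∈ S.UadT T)
    (hy : S.IsState T u y) (hT' : 0 < T') (hle : T' ≤ T) (hend : ‖y T' - S.yd‖ ≤ S.δ₀ + δ) :
    ∃ u' : Control ρ T', S.IsFeasible δ T' u' := by
  obtain ⟨v, hv⟩ := hy.exists_isSolution (hT'.trans_le hle)
  exact ⟨_, exists_isFeasible_of_isSolution hT' ((Lp.memLp u).mono_measure (timeMeasure_mono hle))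
    (ae_mono (timeMeasure_mono hle) hu) (hv.mono hle) hy.2.1 hend⟩

/-- An admissible trajectory which at time `T` is strictly inside the target set was there
already before `T`. -/
theorem exists_isFeasible_lt {δ T : ℝ} (hT : 0 < T) {u : Control ρ T} {y : ℝ → H}
    (hu : u ∈ S.UadT T) (hy : S.IsState T u y) (hend : ‖y T - S.yd‖ < S.δ₀ + δ) :
    ∃ T' < T, ∃ u' : Control ρ T', S.IsFeasible δ T' u' := by
  have hc : ContinuousWithinAt (fun t => ‖y t - S.yd‖) (Icc 0 T) T :=
    ((hy.1.sub continuousOn_const).norm) T ⟨hT.le, le_rfl⟩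
  have h1 : ∀ᶠ t in 𝓝[Ioo 0 T] T, ‖y t - S.yd‖ < S.δ₀ + δ :=
    (hc.mono Ioo_subset_Icc_self).eventually_lt_const hend
  have hne : (𝓝[Ioo 0 T] T).NeBot := by
    rw [nhdsWithin_Ioo_eq_nhdsLT hT]; infer_instance
  obtain ⟨t, ht, htm⟩ := (h1.and self_mem_nhdsWithin).exists
  exact ⟨t, htm.2, exists_isFeasible_of_stop hu hy htm.1 htm.2.le ht.le⟩

theorem IsSolution.eqOn {T : ℝ} {f₁ f₂ : ℝ → V →L[ℝ] ℝ} {w₁ w₂ : ℝ → H} {v₁ v₂ : ℝ → V}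
    (h₁ : S.IsSolution T f₁ w₁ v₁) (h₂ : S.IsSolution T f₂ w₂ v₂)
    (hf : f₁ =ᵐ[timeMeasure T] f₂) (h0 : w₁ 0 = w₂ 0) : EqOn w₁ w₂ (Icc 0 T) := by
  intro t ht
  obtain ⟨C, -, hC⟩ := S.exists_energy_bound T
  have h1 := (hC T ⟨ht.1.trans ht.2, le_rfl⟩ _ _ _ (h₁.sub h₂)).1 t ht
  have h2 : ∫ τ, ‖f₁ τ - f₂ τ‖ ^ 2 ∂(timeMeasure T) = 0 := by
    rw [integral_eq_zero_of_ae]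
    filter_upwards [hf] with τ hτ
    simp [hτ]
  rw [h2, h0] at h1
  have h3 : ‖w₁ t - w₂ t‖ ^ 2 = 0 := le_antisymm (by simpa using h1) (by positivity)
  simpa [sub_eq_zero] using h3

end ControlSystem

/-- A form of the Cauchy-Schwarz inequality, obtained from `‖g‖ ≤ 1 / r + r ‖g‖²` with
`r = √(t - s)`. -/
theorem integral_norm_le_sqrt {X : Type*} [NormedAddCommGroup X] {g : ℝ → X} {s t : ℝ}
    (hst : s ≤ t) (hg : IntervalIntegrable g volume s t)
    (hg2 : IntervalIntegrable (fun τ => ‖g τ‖ ^ 2) volume s t) :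
    ∫ τ in s..t, ‖g τ‖ ≤ √(t - s) * (1 + ∫ τ in s..t, ‖g τ‖ ^ 2) := by
  rcases hst.eq_or_lt with rfl | hlt
  · simp
  set r := √(t - s) with hr
  have hr0 : 0 < r := Real.sqrt_pos.2 (sub_pos.2 hlt)
  have hrr : r * r = t - s := Real.mul_self_sqrt (sub_pos.2 hlt).le
  have hp : ∀ τ, ‖g τ‖ ≤ r⁻¹ + r * ‖g τ‖ ^ 2 := by
    intro τ
    have h1 : 0 ≤ r⁻¹ * (1 - r * ‖g τ‖) ^ 2 := by positivity
    have e : r⁻¹ * (1 - r * ‖g τ‖) ^ 2 = r⁻¹ + r * ‖g τ‖ ^ 2 - 2 * ‖g τ‖ := by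
      field_simp; ring
    linarith [norm_nonneg (g τ)]
  calc ∫ τ in s..t, ‖g τ‖ ≤ ∫ τ in s..t, (r⁻¹ + r * ‖g τ‖ ^ 2) :=
        intervalIntegral.integral_mono_on hst hg.norm
          ((by simp : IntervalIntegrable (fun _ => r⁻¹) volume s t).add (hg2.const_mul r))
          fun τ _ => hp τ
    _ = r * (1 + ∫ τ in s..t, ‖g τ‖ ^ 2) := by
        rw [intervalIntegral.integral_add (by simp) (hg2.const_mul r),
          intervalIntegral.integral_const, intervalIntegral.integral_const_mul, ← hrr, smul_eq_mul]
        field_simp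

namespace ControlSystem

variable {V H Ω : Type*}
  [NormedAddCommGroup V] [InnerProductSpace ℝ V] [CompleteSpace V]
  [NormedAddCommGroup H] [InnerProductSpace ℝ H] [CompleteSpace H]
  [MeasurableSpace Ω] {ρ : Measure Ω} (S : ControlSystem V H ρ)

/-- For data bounded by `R`, the solutions are uniformly Hölder continuous with exponent `1/2` with values in `V*`. -/
theorem exists_holder_bound (T₁ R : ℝ) (y₀ : H) : ∃ C : ℝ, 0 ≤ C ∧ ∀ T ∈ Icc 0 T₁,
    ∀ (f : ℝ → V →L[ℝ] ℝ) (w : ℝ → H) (v : ℝ → V), S.IsSolution T f w v → w 0 = y₀ →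
      (∀ᵐ t ∂(timeMeasure T), ‖f t‖ ≤ R) →
      ∀ s t, 0 ≤ s → s ≤ t → t ≤ T → ∀ x,
        |inner ℝ (w t - w s) (S.j x)| ≤ C * √(t - s) * ‖x‖ := by
  obtain ⟨C, hC0, hC⟩ := S.exists_energy_bound T₁
  set F := R ^ 2 * |T₁| with hF
  set D := C * (‖y₀‖ ^ 2 + F) with hD
  have hF0 : 0 ≤ F := by positivity
  have hD0 : 0 ≤ D := by positivity
  set G := 2 * F + 2 * ‖S.a‖ ^ 2 * D with hG
  have hG0 : 0 ≤ G := by positivity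
  refine ⟨1 + G, by positivity, ?_⟩
  intro T hT f w v h h0 hR
  have hf2 : ∫ τ, ‖f τ‖ ^ 2 ∂(timeMeasure T) ≤ F := by
    calc _ ≤ ∫ _τ, R ^ 2 ∂(timeMeasure T) := by
          refine integral_mono_ae (integrable_norm_sq_of_memLp_two h.memLp_f)
            (integrable_const _) ?_
          filter_upwards [hR] with t ht
          exact pow_le_pow_left₀ (norm_nonneg _) ht 2
      _ = R ^ 2 * T := by
          rw [integral_const, smul_eq_mul, mul_comm]
          congr 1
          simp [measureReal_def, hT.1]
      _ ≤ F := by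
          have := hT.2.trans (le_abs_self T₁)
          rw [hF]
          gcongr
  have hv2 : ∫ τ, ‖v τ‖ ^ 2 ∂(timeMeasure T) ≤ D := by
    refine ((hC T hT f w v h).2).trans ?_
    rw [h0, hD]
    gcongr
  have hg2 : ∫ τ, ‖f τ - S.a (v τ)‖ ^ 2 ∂(timeMeasure T) ≤ G := by
    have i1 := (integrable_norm_sq_of_memLp_two h.memLp_f).const_mul 2
    have i2 := (integrable_norm_sq_of_memLp_two h.evol.memLp_v).const_mul (2 * ‖S.a‖ ^ 2)
    calc _ ≤ ∫ τ, (2 * ‖f τ‖ ^ 2 + 2 * ‖S.a‖ ^ 2 * ‖v τ‖ ^ 2) ∂(timeMeasure T) := by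
          refine integral_mono (integrable_norm_sq_of_memLp_two h.evol.memLp_g) (i1.add i2) ?_
          intro τ
          have h1 : ‖f τ - S.a (v τ)‖ ≤ ‖f τ‖ + ‖S.a‖ * ‖v τ‖ :=
            (norm_sub_le _ _).trans (add_le_add le_rfl (S.a.le_opNorm _))
          have h2 : ‖f τ - S.a (v τ)‖ ^ 2 ≤ (‖f τ‖ + ‖S.a‖ * ‖v τ‖) ^ 2 :=
            pow_le_pow_left₀ (norm_nonneg _) h1 2
          simp only
          nlinarith [sq_nonneg (‖f τ‖ - ‖S.a‖ * ‖v τ‖)]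
      _ ≤ G := by
          rw [integral_add i1 i2, integral_const_mul, integral_const_mul, hG]
          gcongr
  intro s t hs hst ht x
  have hsm : s ∈ Icc 0 T := ⟨hs, hst.trans ht⟩
  have htm : t ∈ Icc 0 T := ⟨hs.trans hst, ht⟩
  have hi1 := intervalIntegrable_of_integrable_timeMeasure
    (h.evol.memLp_g.integrable (by norm_num)) hsm htm
  have hi2 := intervalIntegrable_of_integrable_timeMeasure
    (integrable_norm_sq_of_memLp_two h.evol.memLp_g) hsm htm
  rw [h.evol.inner_sub_eq hsm htm]
  have h1 : |∫ τ in s..t, (f τ - S.a (v τ)) x| ≤ ∫ τ in s..t, ‖f τ - S.a (v τ)‖ * ‖x‖ := by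
    rw [← Real.norm_eq_abs]
    refine intervalIntegral.norm_integral_le_of_norm_le hst (.of_forall fun τ _ => ?_)
      (hi1.norm.mul_const _)
    exact ContinuousLinearMap.le_opNorm _ _
  have h2 : ∫ τ in s..t, ‖f τ - S.a (v τ)‖ ^ 2 ≤ G := by
    refine le_trans ?_ hg2
    rw [intervalIntegral.integral_of_le hst, integral_Ioc_eq_integral_Ioo]
    exact integral_mono_measure (Measure.restrict_mono (Ioo_subset_Ioo hs ht) le_rfl)
      (.of_forall fun _ => by positivity) (integrable_norm_sq_of_memLp_two h.evol.memLp_g)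
  rw [intervalIntegral.integral_mul_const] at h1
  refine h1.trans ?_
  gcongr
  refine (integral_norm_le_sqrt hst hi1 hi2).trans ?_
  rw [mul_comm]
  exact mul_le_mul_of_nonneg_right (by linarith) (Real.sqrt_nonneg _)

end ControlSystem

/-! ### Limits of solutions and strongly convergent convex combinations -/

namespace ControlSystem

variable {V H Ω : Type*}
  [NormedAddCommGroup V] [InnerProductSpace ℝ V] [CompleteSpace V]
  [NormedAddCommGroup H] [InnerProductSpace ℝ H] [CompleteSpace H]
  [MeasurableSpace Ω] {ρ : Measure Ω} {S : ControlSystem V H ρ}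

/-- Strong `L²(V*)`-limits of data for which the equation is solvable with a given initial value
are again data of this kind, and the solutions converge: by the a priori estimate the solutions form
a Cauchy sequence in `C([0, T]; H) ∩ L²(0, T; V)`. -/
theorem exists_isSolution_of_tendsto {T : ℝ} (hT : 0 ≤ T) {f : ℕ → ℝ → V →L[ℝ] ℝ}
    {w : ℕ → ℝ → H} {v : ℕ → ℝ → V} {f' : ℝ → V →L[ℝ] ℝ} {y₀ : H}
    (h : ∀ k, S.IsSolution T (f k) (w k) (v k)) (h0 : ∀ k, w k 0 = y₀)
    (hf' : MemLp f' 2 (timeMeasure T))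
    (hlim : Tendsto (fun k => eLpNorm (f k - f') 2 (timeMeasure T)) atTop (𝓝 0)) :
    ∃ w' v', S.IsSolution T f' w' v' ∧ ∀ t ∈ Icc 0 T, Tendsto (fun k => w k t) atTop (𝓝 (w' t)) := by
  obtain ⟨C, hC0, hC⟩ := S.exists_energy_bound T
  let F : ℕ → Lp (V →L[ℝ] ℝ) 2 (timeMeasure T) := fun k => (h k).memLp_f.toLp (f k)
  let U : ℕ → Lp V 2 (timeMeasure T) := fun k => (h k).evol.memLp_v.toLp (v k)
  have hF : CauchySeq F :=
    ((Lp.tendsto_Lp_iff_tendsto_eLpNorm'' f (fun k => (h k).memLp_f) f' hf').2 hlim).cauchySeq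
  have hbound : ∀ k l, (∀ t ∈ Icc 0 T, dist (w k t) (w l t) ≤ √C * dist (F k) (F l)) ∧
      dist (U k) (U l) ≤ √C * dist (F k) (F l) := by
    intro k l
    have h1 := hC T ⟨hT, le_rfl⟩ _ _ _ ((h k).sub (h l))
    rw [integral_norm_sq_toLp_sub (h k).memLp_f (h l).memLp_f,
      integral_norm_sq_toLp_sub (h k).evol.memLp_v (h l).evol.memLp_v, h0, h0] at h1
    simp only [sub_self, norm_zero, ne_eq, OfNat.ofNat_ne_zero, not_false_eq_true, zero_pow,
      zero_add] at h1
    have e : C * ‖F k - F l‖ ^ 2 = (√C * dist (F k) (F l)) ^ 2 := by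
      rw [mul_pow, Real.sq_sqrt hC0, dist_eq_norm]
    have hnn : 0 ≤ √C * dist (F k) (F l) := by positivity
    refine ⟨fun t ht => ?_, ?_⟩
    · rw [dist_eq_norm]
      exact le_of_sq_le_sq ((h1.1 t ht).trans e.le) hnn
    · rw [dist_eq_norm (U k)]
      exact le_of_sq_le_sq (h1.2.trans e.le) hnn
  have hsmall : ∀ ε > 0, ∃ N, ∀ m ≥ N, ∀ n ≥ N, √C * dist (F m) (F n) < ε := by
    intro ε hε
    obtain ⟨N, hN⟩ := Metric.cauchySeq_iff.1 hF (ε / (√C + 1)) (by positivity)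
    refine ⟨N, fun m hm n hn => ?_⟩
    have h1 := hN m hm n hn
    rw [lt_div_iff₀ (by positivity)] at h1
    nlinarith [dist_nonneg (x := F m) (y := F n)]
  have hU : CauchySeq U := by
    refine Metric.cauchySeq_iff.2 fun ε hε => ?_
    obtain ⟨N, hN⟩ := hsmall ε hε
    exact ⟨N, fun m hm n hn => (hbound m n).2.trans_lt (hN m hm n hn)⟩
  have hw : UniformCauchySeqOn w atTop (Icc 0 T) := by
    refine Metric.uniformCauchySeqOn_iff.2 fun ε hε => ?_
    obtain ⟨N, hN⟩ := hsmall ε hε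
    exact ⟨N, fun m hm n hn t ht => ((hbound m n).1 t ht).trans_lt (hN m hm n hn)⟩
  obtain ⟨U', hv'⟩ := cauchySeq_tendsto_of_complete hU
  obtain ⟨v', hvU⟩ : ∃ v' : ℝ → V, v' = U' := ⟨_, rfl⟩
  have hvm' : MemLp v' 2 (timeMeasure T) := hvU ▸ Lp.memLp U'
  have hex : ∀ t ∈ Icc 0 T, ∃ z, Tendsto (fun k => w k t) atTop (𝓝 z) := fun t ht =>
    cauchySeq_tendsto_of_complete (hw.cauchySeq ht)
  choose! w' hw' using hex
  have hunif := hw.tendstoUniformlyOn_of_tendsto hw'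
  have hvlim : Tendsto (fun k => eLpNorm (v k - v') 2 (timeMeasure T)) atTop (𝓝 0) := by
    have := (Lp.tendsto_Lp_iff_tendsto_eLpNorm' U U').1 hv'
    rw [← hvU] at this
    refine this.congr fun k => eLpNorm_congr_ae ?_
    filter_upwards [(h k).evol.memLp_v.coeFn_toLp] with t ht
    simp only [Pi.sub_apply, U, ht]
  refine ⟨w', v', ⟨hf', ?_, hvm', hf'.sub (memLp_a_comp (hvm')), ?_, ?_⟩, hw'⟩
  · exact hunif.continuousOn (Eventually.frequently (.of_forall fun k => (h k).evol.cont))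
  · -- along a subsequence `v k` converges almost everywhere
    have hae : ∀ᵐ t ∂(timeMeasure T), ∀ k, w k t = S.j (U k t) := by
      refine ae_all_iff.2 fun k => ?_
      filter_upwards [(h k).evol.ae_eq, (h k).evol.memLp_v.coeFn_toLp] with t h1 h2
      rw [h1, h2]
    obtain ⟨ns, hns, hsub⟩ := (tendstoInMeasure_of_tendsto_Lp hv').exists_seq_tendsto_ae
    rw [← hvU] at hsub
    filter_upwards [hae, hsub, ae_restrict_mem measurableSet_Ioo] with t h1 h2 h3
    refine tendsto_nhds_unique ((hw' t (Ioo_subset_Icc_self h3)).comp hns.tendsto_atTop) ?_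
    refine ((S.j.continuous.tendsto _).comp h2).congr fun i => ?_
    simp only [Function.comp_apply, h1]
  · intro t ht x
    have hle := timeMeasure_mono ht.2
    have hL : Tendsto (fun k => inner ℝ (w k t - w k 0) (S.j x)) atTop
        (𝓝 (inner ℝ (w' t - w' 0) (S.j x))) :=
      ((hw' t ht).sub (hw' 0 ⟨le_rfl, hT⟩)).inner tendsto_const_nhds
    refine tendsto_nhds_unique hL ?_
    have hgm : MemLp (fun τ => f' τ - S.a (v' τ)) 2 (timeMeasure T) :=
      hf'.sub (memLp_a_comp (hvm'))
    have hG : Tendsto (fun k => eLpNorm ((fun τ => f k τ - S.a (v k τ))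
        - fun τ => f' τ - S.a (v' τ)) 2 (timeMeasure T)) atTop (𝓝 0) := by
      have hadd : Tendsto (fun k => eLpNorm (f k - f') 2 (timeMeasure T)
          + ENNReal.ofReal ‖S.a‖ * eLpNorm (v k - v') 2 (timeMeasure T)) atTop (𝓝 0) := by
        have := hlim.add (ENNReal.Tendsto.const_mul hvlim
          (Or.inr (ENNReal.ofReal_ne_top (r := ‖S.a‖))))
        simpa using this
      refine tendsto_of_tendsto_of_tendsto_of_le_of_le tendsto_const_nhds hadd
        (fun _ => bot_le) fun k => ?_
      have e : ((fun τ => f k τ - S.a (v k τ)) - fun τ => f' τ - S.a (v' τ))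
          = (f k - f') - fun τ => S.a ((v k - v') τ) := by
        ext τ x; simp; ring
      have hvm := (h k).evol.memLp_v.sub (hvm')
      simp only [e]
      refine (eLpNorm_sub_le ((h k).memLp_f.sub hf').1 (memLp_a_comp hvm).1
        (by norm_num)).trans (add_le_add le_rfl ?_)
      exact eLpNorm_le_mul_eLpNorm_of_ae_le_mul (.of_forall fun τ => S.a.le_opNorm _) 2
    have hconst : Tendsto (fun _ : ℕ => eLpNorm ((fun _ : ℝ => x) - fun _ : ℝ => x) 2
        (timeMeasure t)) atTop (𝓝 0) := by simp
    have key := tendsto_integral_apply_of_tendsto_eLpNorm (μ := timeMeasure t)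
      (U := fun _ _ => x) (v := fun _ => x)
      (fun k => (h k).evol.memLp_g.mono_measure hle) (hgm.mono_measure hle)
      (fun _ => memLp_const x) (memLp_const x)
      (tendsto_of_tendsto_of_tendsto_of_le_of_le tendsto_const_nhds hG
        (fun _ => bot_le) fun k => eLpNorm_mono_measure _ hle) hconst
    rw [intervalIntegral_eq_timeMeasure ht.1]
    refine key.congr fun k => ?_
    rw [(h k).evol.inner_eq t ht, intervalIntegral_eq_timeMeasure ht.1]

theorem IsSolution.congr_state {T : ℝ} {f : ℝ → V →L[ℝ] ℝ} {w₁ w₂ : ℝ → H} {v₁ v₂ : ℝ → V}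
    (h : S.IsSolution T f w₁ v₁) (hw : EqOn w₂ w₁ (Icc 0 T)) (hv : v₂ =ᵐ[timeMeasure T] v₁) :
    S.IsSolution T f w₂ v₂ where
  memLp_f := h.memLp_f
  evol :=
    have hv2 := (memLp_congr_ae hv).2 h.evol.memLp_v
    { cont := h.evol.cont.congr hw
      memLp_v := hv2
      memLp_g := h.memLp_f.sub (memLp_a_comp hv2)
      ae_eq := by
        filter_upwards [hv, h.evol.ae_eq, ae_restrict_mem measurableSet_Ioo] with t h1 h2 h3
        rw [hw (Ioo_subset_Icc_self h3), h1, h2]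
      inner_eq := fun t ht x => by
        rw [hw ht, hw ⟨le_rfl, ht.1.trans ht.2⟩, h.evol.inner_eq t ht,
          intervalIntegral_eq_timeMeasure ht.1, intervalIntegral_eq_timeMeasure ht.1]
        apply integral_congr_ae
        filter_upwards [ae_mono (timeMeasure_mono ht.2) hv] with τ hτ
        rw [hτ] }

end ControlSystem

section Hilbert

variable {E : Type*} [NormedAddCommGroup E] [InnerProductSpace ℝ E]

/-- A bounded sequence in a Hilbert space has strongly convergent convex combinations of its tails.
Elements of nearly minimal norm in the convex hulls of the tails form a Cauchy sequence by the
parallelogram law. -/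
theorem exists_tendsto_convexHull_tail [CompleteSpace E] {x : ℕ → E} {R : ℝ}
    (hR : ∀ n, ‖x n‖ ≤ R) :
    ∃ (p : ℕ → E) (c : E), (∀ k, p k ∈ convexHull ℝ (x '' Ici k)) ∧ Tendsto p atTop (𝓝 c) := by
  let K : ℕ → Set E := fun k => convexHull ℝ (x '' Ici k)
  have hmem : ∀ k, x k ∈ K k := fun k => subset_convexHull ℝ _ ⟨k, mem_Ici.2 le_rfl, rfl⟩
  have hanti : ∀ {k m}, k ≤ m → K m ⊆ K k := fun h =>
    convexHull_mono (image_mono (Ici_subset_Ici.2 h))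
  let d : ℕ → ℝ := fun k => sInf (norm '' K k)
  have hbdd : ∀ k, BddBelow (norm '' K k) := fun k =>
    ⟨0, by rintro _ ⟨z, _, rfl⟩; exact norm_nonneg z⟩
  have hdle : ∀ k, ∀ z ∈ K k, d k ≤ ‖z‖ := fun k z hz => csInf_le (hbdd k) ⟨z, hz, rfl⟩
  have hne : ∀ k, (norm '' K k).Nonempty := fun k => ⟨_, x k, hmem k, rfl⟩
  have hd0 : ∀ k, 0 ≤ d k := fun k =>
    le_csInf (hne k) (by rintro _ ⟨z, _, rfl⟩; exact norm_nonneg z)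
  have hdmono : Monotone d := fun k m h =>
    csInf_le_csInf (hbdd k) (hne m) (image_mono (hanti h))
  have hdR : ∀ k, d k ≤ R := fun k => (hdle k _ (hmem k)).trans (hR k)
  have hlimd := tendsto_atTop_ciSup hdmono ⟨R, by rintro _ ⟨k, rfl⟩; exact hdR k⟩
  set D := ⨆ k, d k
  have hp : ∀ k : ℕ, ∃ z ∈ K k, ‖z‖ < d k + 1 / ((k : ℝ) + 1) := by
    intro k
    obtain ⟨_, ⟨z, hz, rfl⟩, hlt⟩ :=
      exists_lt_of_csInf_lt (hne k) (lt_add_of_pos_right (d k) (Nat.one_div_pos_of_nat (n := k)))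
    exact ⟨z, hz, hlt⟩
  choose p hpK hplt using hp
  have hlimp : Tendsto (fun k => ‖p k‖) atTop (𝓝 D) := by
    refine tendsto_of_tendsto_of_tendsto_of_le_of_le hlimd ?_ (fun k => hdle k _ (hpK k))
      fun k => (hplt k).le
    simpa using hlimd.add (tendsto_one_div_add_atTop_nhds_zero_nat (𝕜 := ℝ))
  have hcauchy : CauchySeq p := by
    refine Metric.cauchySeq_iff'.2 fun ε hε => ?_
    have he : 0 < ε ^ 2 / 16 := by positivity
    have h1 := (hlimd.pow 2).eventually_const_lt (sub_lt_self (D ^ 2) he)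
    have h2 := (hlimp.pow 2).eventually_lt_const (lt_add_of_pos_right (D ^ 2) he)
    obtain ⟨N, hN⟩ := eventually_atTop.1 (h1.and h2)
    refine ⟨N, fun n hn => ?_⟩
    -- the midpoint of `p n` and `p N` has norm at least `d N`
    have hmid : (1 / 2 : ℝ) • p n + (1 / 2 : ℝ) • p N ∈ K N :=
      convex_convexHull ℝ _ (hanti hn (hpK n)) (hpK N) (by norm_num) (by norm_num) (by norm_num)
    have h3 := hdle N _ hmid
    rw [← smul_add, norm_smul] at h3
    norm_num at h3
    have h4 : (2 * d N) ^ 2 ≤ ‖p n + p N‖ ^ 2 :=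
      pow_le_pow_left₀ (by linarith [hd0 N]) (by linarith) 2
    have h5 := parallelogram_law_with_norm ℝ (p n) (p N)
    have h6 := (hN N le_rfl).1
    have h7 := (hN N le_rfl).2
    have h8 := (hN n hn).2
    rw [dist_eq_norm]
    refine lt_of_pow_lt_pow_left₀ 2 hε.le ?_
    nlinarith
  obtain ⟨c, hc⟩ := cauchySeq_tendsto_of_complete hcauchy
  exact ⟨p, c, hpK, hc⟩

theorem norm_le_of_dense_inner_le {F : Type*} {e : F → E} (he : DenseRange e) {z : E} {M : ℝ} (hM : 0 ≤ M)
    (h : ∀ x, |inner ℝ z (e x)| ≤ M * ‖e x‖) : ‖z‖ ≤ M := by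
  have hall : ∀ y, |inner ℝ z y| ≤ M * ‖y‖ := by
    have hcl : IsClosed {y : E | |inner ℝ z y| ≤ M * ‖y‖} :=
      isClosed_le (by fun_prop) (by fun_prop)
    exact fun y => he.induction_on (p := fun y => |inner ℝ z y| ≤ M * ‖y‖) y hcl h
  have h1 := hall z
  rw [real_inner_self_eq_norm_sq, abs_of_nonneg (by positivity), pow_two] at h1
  rcases (norm_nonneg z).eq_or_lt with h0 | h0
  · exact h0 ▸ hM
  · exact le_of_mul_le_mul_right h1 h0

end Hilbert

/-! ### Extension of solutions to the endpoint -/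

/-- Square-integrability on `(0, T)` follows from uniform bounds on the intervals `(0, s)`,
`s < T`. -/
theorem memLp_two_timeMeasure_of_forall_lt {X : Type*} [NormedAddCommGroup X] {T : ℝ}
    (hT : 0 < T) {f : ℝ → X} {M : ℝ} (hf : ∀ s, 0 < s → s < T → MemLp f 2 (timeMeasure s))
    (hM : ∀ s, 0 < s → s < T → ∫ t, ‖f t‖ ^ 2 ∂(timeMeasure s) ≤ M) :
    MemLp f 2 (timeMeasure T) := by
  obtain ⟨b, -, hb, hblim⟩ := exists_seq_strictMono_tendsto' hT
  have hcov : AECover (timeMeasure T) atTop fun n => Ioo 0 (b n) :=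
    aecover_Ioo_of_Ioo tendsto_const_nhds hblim
  have hres : ∀ n, (timeMeasure T).restrict (Ioo 0 (b n)) = timeMeasure (b n) := fun n => by
    rw [Measure.restrict_restrict measurableSet_Ioo,
      inter_eq_left.2 (Ioo_subset_Ioo_right (hb n).2.le)]
  have hmeas : AEStronglyMeasurable f (timeMeasure T) :=
    hcov.aestronglyMeasurable fun n => by rw [hres]; exact (hf _ (hb n).1 (hb n).2).1
  rw [memLp_two_iff_integrable_sq_norm hmeas]
  refine hcov.integrable_of_integral_bounded_of_nonneg_ae M (fun n => ?_)
    (.of_forall fun _ => by positivity) (.of_forall fun n => ?_)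
  · rw [IntegrableOn, hres]
    exact integrable_norm_sq_of_memLp_two (hf _ (hb n).1 (hb n).2)
  · rw [hres]
    exact hM _ (hb n).1 (hb n).2

theorem ae_timeMeasure_of_forall_lt {T : ℝ} (hT : 0 < T) {p : ℝ → Prop}
    (h : ∀ s, 0 < s → s < T → ∀ᵐ t ∂(timeMeasure s), p t) : ∀ᵐ t ∂(timeMeasure T), p t := by
  obtain ⟨b, -, hb, hblim⟩ := exists_seq_strictMono_tendsto' hT
  have hall : ∀ᵐ t, ∀ n, t ∈ Ioo 0 (b n) → p t :=
    ae_all_iff.2 fun n => (ae_restrict_iff' measurableSet_Ioo).1 (h _ (hb n).1 (hb n).2)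
  rw [ae_restrict_iff' measurableSet_Ioo]
  filter_upwards [hall] with t ht htm
  obtain ⟨n, hn⟩ := (hblim.eventually_const_lt htm.2).exists
  exact ht n ⟨htm.1, hn⟩

/-- A trajectory in `L²(0, T; V)` with derivative in `L²(0, T; V*)` has a limit in `H` at the
endpoint `T`. The base points `s` of the Cauchy estimate are chosen such that `(T - s) ‖v s‖²`
does not exceed the integral of `2 ‖v‖²` near `T`. -/
theorem exists_tendsto_endpoint {V H : Type*}
    [NormedAddCommGroup V] [InnerProductSpace ℝ V] [CompleteSpace V]
    [NormedAddCommGroup H] [InnerProductSpace ℝ H] [CompleteSpace H] {j : V →L[ℝ] H} {T : ℝ} (hT : 0 < T) {g : ℝ → V →L[ℝ] ℝ}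
    {w : ℝ → H} {v : ℝ → V} (h : ∀ s, 0 < s → s < T → IsEvolution j s g w v)
    (hv : MemLp v 2 (timeMeasure T)) (hg : MemLp g 2 (timeMeasure T)) :
    ∃ y, Tendsto w (𝓝[<] T) (𝓝 y) := by
  have hv2 := integrable_norm_sq_of_memLp_two hv
  have hg2 := integrable_norm_sq_of_memLp_two hg
  have hvi : ∀ {s t}, s ∈ Icc 0 T → t ∈ Icc 0 T →
      IntervalIntegrable (fun τ => ‖v τ‖ ^ 2) volume s t :=
    fun hs ht => intervalIntegrable_of_integrable_timeMeasure hv2 hs ht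
  have hgi : ∀ {s t}, s ∈ Icc 0 T → t ∈ Icc 0 T →
      IntervalIntegrable (fun τ => ‖g τ‖ ^ 2) volume s t :=
    fun hs ht => intervalIntegrable_of_integrable_timeMeasure hg2 hs ht
  have hTm : T ∈ Icc 0 T := ⟨hT.le, le_rfl⟩
  have h0m : (0 : ℝ) ∈ Icc 0 T := ⟨le_rfl, hT.le⟩
  -- the tails of the integrals of `‖v‖²` and `‖g‖²` are small
  have htail : Tendsto (fun s => ∫ τ in s..T, (‖v τ‖ ^ 2 + ‖g τ‖ ^ 2)) (𝓝[Icc 0 T] T) (𝓝 0) := by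
    have hi : IntervalIntegrable (fun τ => ‖v τ‖ ^ 2 + ‖g τ‖ ^ 2) volume T 0 :=
      (hvi hTm h0m).add (hgi hTm h0m)
    have hc := intervalIntegral.continuousOn_primitive_interval' hi (a := T) (by simp)
    rw [uIcc_of_ge hT.le] at hc
    have := (hc T hTm).tendsto.neg
    simp only [intervalIntegral.integral_same, neg_zero] at this
    exact this.congr fun s => (intervalIntegral.integral_symm _ _).symm
  have hne : ∀ᵐ t, t ∈ Ioo 0 T → w t = j (v t) :=
    (ae_restrict_iff' measurableSet_Ioo).1
      (ae_timeMeasure_of_forall_lt hT fun s h1 h2 => (h s h1 h2).ae_eq)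
  have hcauchy : ∀ ε > 0, ∃ s, 0 < s ∧ s < T ∧ ∀ t ∈ Ico s T, ‖w t - w s‖ < ε := by
    intro ε hε
    obtain ⟨a, ha, ham⟩ : ∃ a, (∫ τ in a..T, (‖v τ‖ ^ 2 + ‖g τ‖ ^ 2) < ε ^ 2 / 4) ∧
        a ∈ Ioo 0 T := by
      have hnb : (𝓝[Ioo 0 T] T).NeBot := by
        rw [nhdsWithin_Ioo_eq_nhdsLT hT]; infer_instance
      exact (((htail.mono_left (nhdsWithin_mono _ Ioo_subset_Icc_self)).eventually_lt_const
        (by positivity)).and self_mem_nhdsWithin).exists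
    have ham' : a ∈ Icc 0 T := Ioo_subset_Icc_self ham
    set m := (a + T) / 2 with hm
    have ham2 : a < m := by rw [hm]; linarith [ham.2]
    have hmT : m < T := by rw [hm]; linarith [ham.2]
    have hmm : m ∈ Icc 0 T := ⟨by linarith [ham.1], hmT.le⟩
    set I := ∫ τ in a..T, ‖v τ‖ ^ 2 with hI
    set J := ∫ τ in a..T, ‖g τ‖ ^ 2 with hJ
    have hIJ : I + J < ε ^ 2 / 4 := by
      rwa [intervalIntegral.integral_add (hvi ham' hTm) (hgi ham' hTm)] at ha
    -- the choice of the base point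
    obtain ⟨s, hsm, hws, hvs⟩ : ∃ s ∈ Ioo a m, w s = j (v s) ∧ (T - s) * ‖v s‖ ^ 2 ≤ 2 * I := by
      have hμ : volume.restrict (Ioo a m) ≠ 0 := by
        rw [Ne, Measure.restrict_eq_zero, Real.volume_Ioo]
        simp [ham2]
      have hint : Integrable (fun τ => ‖v τ‖ ^ 2) (volume.restrict (Ioo a m)) :=
        (intervalIntegrable_iff_integrableOn_Ioo_of_le ham2.le).1 (hvi ham' hmm)
      have hN : ∀ᵐ s ∂(volume.restrict (Ioo a m)), s ∈ Ioo a m ∧ w s = j (v s) := by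
        rw [ae_restrict_iff' measurableSet_Ioo]
        filter_upwards [hne] with s hs hsm
        exact ⟨hsm, hs ⟨ham.1.trans hsm.1, hsm.2.trans hmT⟩⟩
      obtain ⟨s, hs, hle⟩ := exists_notMem_null_le_average hμ hint (ae_iff.1 hN)
      simp only [mem_ofPred_eq, not_not] at hs
      refine ⟨s, hs.1, hs.2, ?_⟩
      rw [setAverage_eq, smul_eq_mul, measureReal_def, Real.volume_Ioo,
        ENNReal.toReal_ofReal (sub_pos.2 ham2).le, ← integral_Ioc_eq_integral_Ioo,
        ← intervalIntegral.integral_of_le ham2.le, ← div_eq_inv_mul,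
        le_div_iff₀ (sub_pos.2 ham2)] at hle
      have h1 : ∫ τ in a..m, ‖v τ‖ ^ 2 ≤ I :=
        intervalIntegral.integral_mono_interval le_rfl ham2.le hmT.le
          (.of_forall fun _ => by positivity) (hvi ham' hTm)
      have h2 : T - s ≤ 2 * (m - a) := by rw [hm]; linarith [hs.1.1]
      have h3 : 0 ≤ ‖v s‖ ^ 2 := by positivity
      nlinarith
    have hs0 : 0 < s := ham.1.trans hsm.1
    have hsT : s < T := hsm.2.trans hmT
    refine ⟨s, hs0, hsT, fun t ht => ?_⟩
    have hE := h t (hs0.trans_le ht.1) ht.2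
    have hsm' : s ∈ Icc 0 T := ⟨hs0.le, hsT.le⟩
    have htm' : t ∈ Icc 0 T := ⟨hs0.le.trans ht.1, ht.2.le⟩
    have e1 := hE.energy_identity hs0.le ht.1 le_rfl
    have e2 := hE.inner_sub_eq ⟨hs0.le, ht.1⟩ ⟨hs0.le.trans ht.1, le_rfl⟩ (v s)
    rw [← hws] at e2
    have e3 : ‖w t - w s‖ ^ 2
        = ‖w t‖ ^ 2 - ‖w s‖ ^ 2 - 2 * inner ℝ (w t - w s) (w s) := by
      rw [norm_sub_sq_real, inner_sub_left, real_inner_self_eq_norm_sq]; ring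
    have i1 : IntervalIntegrable (fun τ => g τ (v τ)) volume s t :=
      intervalIntegrable_of_integrable_timeMeasure (integrable_apply_of_memLp_two hg hv) hsm' htm'
    have i2 : IntervalIntegrable (fun τ => g τ (v s)) volume s t :=
      intervalIntegrable_of_integrable_timeMeasure
        (integrable_apply_const_of_memLp_two hg _) hsm' htm'
    have i3 := hvi hsm' htm'
    have i4 := hgi hsm' htm'
    have e4 : ‖w t - w s‖ ^ 2 = ∫ τ in s..t, (2 * g τ (v τ) - 2 * g τ (v s)) := by
      rw [e3, e1, e2, intervalIntegral.integral_sub (i1.const_mul 2) (i2.const_mul 2),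
        intervalIntegral.integral_const_mul, intervalIntegral.integral_const_mul]
    have e5 : ∫ τ in s..t, (2 * g τ (v τ) - 2 * g τ (v s))
        ≤ ∫ τ in s..t, ((‖v τ‖ ^ 2 + 2 * ‖g τ‖ ^ 2) + ‖v s‖ ^ 2) := by
      refine intervalIntegral.integral_mono_on ht.1 ((i1.const_mul 2).sub (i2.const_mul 2))
        ((i3.add (i4.const_mul 2)).add (by simp)) fun τ _ => ?_
      have a1 := (le_abs_self _).trans ((g τ).le_opNorm (v τ))
      have a2 := (neg_abs_le _).trans' (neg_le_neg ((g τ).le_opNorm (v s)))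
      nlinarith [sq_nonneg (‖g τ‖ - ‖v τ‖), sq_nonneg (‖g τ‖ - ‖v s‖)]
    rw [intervalIntegral.integral_add (i3.add (i4.const_mul 2)) (by simp),
      intervalIntegral.integral_add i3 (i4.const_mul 2), intervalIntegral.integral_const_mul,
      intervalIntegral.integral_const, smul_eq_mul] at e5
    have e6 : ∫ τ in s..t, ‖v τ‖ ^ 2 ≤ I :=
      intervalIntegral.integral_mono_interval hsm.1.le ht.1 ht.2.le
        (.of_forall fun _ => by positivity) (hvi ham' hTm)
    have e7 : ∫ τ in s..t, ‖g τ‖ ^ 2 ≤ J :=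
      intervalIntegral.integral_mono_interval hsm.1.le ht.1 ht.2.le
        (.of_forall fun _ => by positivity) (hgi ham' hTm)
    have e8 : (t - s) * ‖v s‖ ^ 2 ≤ 2 * I := by
      refine le_trans ?_ hvs
      have := ht.2.le
      gcongr
    have hJ0 : 0 ≤ J := intervalIntegral.integral_nonneg ham.2.le fun _ _ => by positivity
    have hI0 : 0 ≤ I := intervalIntegral.integral_nonneg ham.2.le fun _ _ => by positivity
    refine lt_of_pow_lt_pow_left₀ 2 hε.le ?_
    rw [e4]
    linarith
  have hmap : Cauchy (map w (𝓝[<] T)) := by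
    refine Metric.cauchy_iff.2 ⟨inferInstance, fun ε hε => ?_⟩
    obtain ⟨s, hs0, hsT, hs⟩ := hcauchy (ε / 2) (by positivity)
    refine ⟨w '' Ico s T, image_mem_map (Ico_mem_nhdsLT hsT), ?_⟩
    rintro _ ⟨t, ht, rfl⟩ _ ⟨t', ht', rfl⟩
    have h1 := hs t ht
    have h2 := hs t' ht'
    rw [← dist_eq_norm] at h1 h2
    linarith [dist_triangle_right (w t) (w t') (w s)]
  obtain ⟨y, hy⟩ := CompleteSpace.complete hmap
  exact ⟨y, hy⟩

namespace ControlSystem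

variable {V H Ω : Type*}
  [NormedAddCommGroup V] [InnerProductSpace ℝ V] [CompleteSpace V]
  [NormedAddCommGroup H] [InnerProductSpace ℝ H] [CompleteSpace H]
  [MeasurableSpace Ω] {ρ : Measure Ω} {S : ControlSystem V H ρ}

/-- If the equation is solvable on `(0, s)` for every `s < T`, then it is solvable on `(0, T)`. -/
theorem exists_isSolution_of_forall_lt {T : ℝ} (hT : 0 < T) {f : ℝ → V →L[ℝ] ℝ}
    (hf : MemLp f 2 (timeMeasure T)) {y₀ : H}
    (h : ∀ s, 0 < s → s < T → ∃ w v, S.IsSolution s f w v ∧ w 0 = y₀) :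
    ∃ w v, S.IsSolution T f w v ∧ w 0 = y₀ := by
  choose! w v hsol h0 using h
  -- the solutions are glued by uniqueness
  let W₀ : ℝ → H := fun t => w ((t + T) / 2) t
  have hW₀ : ∀ s, 0 < s → s < T → EqOn W₀ (w s) (Icc 0 s) := by
    intro s hs0 hsT t ht
    have h1 : 0 < (t + T) / 2 := by linarith [ht.1]
    have h2 : (t + T) / 2 < T := by linarith [ht.2]
    have h3 : t ≤ (t + T) / 2 := by linarith [ht.2]
    exact ((hsol _ h1 h2).mono h3).eqOn ((hsol s hs0 hsT).mono ht.2) (ae_eq_refl _)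
      (by rw [h0 _ h1 h2, h0 s hs0 hsT]) ⟨ht.1, le_rfl⟩
  let U : ℝ → V := fun t => Function.invFun S.j (W₀ t)
  have hsol₀ : ∀ s, 0 < s → s < T → S.IsSolution s f W₀ U := by
    intro s hs0 hsT
    refine (hsol s hs0 hsT).congr_state (hW₀ s hs0 hsT) ?_
    filter_upwards [(hsol s hs0 hsT).evol.ae_eq, ae_restrict_mem measurableSet_Ioo] with t h1 h2
    simp only [U]
    rw [hW₀ s hs0 hsT (Ioo_subset_Icc_self h2), h1, Function.leftInverse_invFun S.j_injective]
  have hW₀0 : W₀ 0 = y₀ := by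
    have h1 : 0 < T / 2 := by linarith
    have h2 : T / 2 < T := by linarith
    rw [hW₀ _ h1 h2 ⟨le_rfl, h1.le⟩, h0 _ h1 h2]
  obtain ⟨C, hC0, hC⟩ := S.exists_energy_bound T
  have hU : MemLp U 2 (timeMeasure T) := by
    refine memLp_two_timeMeasure_of_forall_lt hT
      (M := C * (‖y₀‖ ^ 2 + ∫ τ, ‖f τ‖ ^ 2 ∂(timeMeasure T)))
      (fun s h1 h2 => (hsol₀ s h1 h2).evol.memLp_v) fun s h1 h2 => ?_
    refine (hC s ⟨h1.le, h2.le⟩ _ _ _ (hsol₀ s h1 h2)).2.trans ?_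
    rw [hW₀0]
    refine mul_le_mul_of_nonneg_left (add_le_add le_rfl ?_) hC0
    exact integral_mono_measure (timeMeasure_mono h2.le) (.of_forall fun _ => by positivity)
      (integrable_norm_sq_of_memLp_two hf)
  have hg : MemLp (fun t => f t - S.a (U t)) 2 (timeMeasure T) := hf.sub (memLp_a_comp hU)
  obtain ⟨y, hy⟩ := exists_tendsto_endpoint hT (fun s h1 h2 => (hsol₀ s h1 h2).evol) hU hg
  let W : ℝ → H := Function.update W₀ T y
  have hWW : ∀ t, t < T → W t = W₀ t := fun t ht => Function.update_of_ne ht.ne _ _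
  have hsolW : ∀ s, 0 < s → s < T → S.IsSolution s f W U := fun s h1 h2 =>
    (hsol₀ s h1 h2).congr_state (fun t ht => hWW t (ht.2.trans_lt h2)) (ae_eq_refl _)
  have hWT : Tendsto W (𝓝[<] T) (𝓝 (W T)) := by
    have : W T = y := Function.update_self _ _ _
    rw [this]
    refine hy.congr' ?_
    filter_upwards [self_mem_nhdsWithin] with t ht
    exact (hWW t ht).symm
  have hW0 : W 0 = y₀ := by rw [hWW 0 hT, hW₀0]
  refine ⟨W, U, ⟨hf, ?_, hU, hg, ?_, ?_⟩, hW0⟩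
  · intro t ht
    rcases ht.2.lt_or_eq with hlt | rfl
    · have h1 : 0 < (t + T) / 2 := by linarith [ht.1]
      have h2 : (t + T) / 2 < T := by linarith
      have h3 : t < (t + T) / 2 := by linarith
      refine ((hsolW _ h1 h2).evol.cont t ⟨ht.1, h3.le⟩).mono_of_mem_nhdsWithin ?_
      filter_upwards [self_mem_nhdsWithin, mem_nhdsWithin_of_mem_nhds (Iio_mem_nhds h3)]
        with r h4 h5
      exact ⟨h4.1, le_of_lt h5⟩
    · have h1 : ContinuousWithinAt W (Iic t) t := continuousWithinAt_Iio_iff_Iic.1 hWT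
      exact h1.mono fun r hr => hr.2
  · exact ae_timeMeasure_of_forall_lt hT fun s h1 h2 => (hsolW s h1 h2).evol.ae_eq
  · intro t ht x
    rcases ht.2.lt_or_eq with hlt | rfl
    · rcases ht.1.eq_or_lt with rfl | hpos
      · simp
      · exact (hsolW t hpos hlt).evol.inner_eq t ⟨ht.1, le_rfl⟩ x
    · have hi := intervalIntegrable_of_integrable_timeMeasure
        (integrable_apply_const_of_memLp_two hg x) ⟨le_rfl, hT.le⟩ ht
      have hc := intervalIntegral.continuousOn_primitive_interval' hi (a := 0) (by simp)
      rw [uIcc_of_le hT.le] at hc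
      have hR : Tendsto (fun s => ∫ τ in (0 : ℝ)..s, (f τ - S.a (U τ)) x) (𝓝[<] t)
          (𝓝 (∫ τ in (0 : ℝ)..t, (f τ - S.a (U τ)) x)) := by
        rw [← nhdsWithin_Ioo_eq_nhdsLT hT]
        exact (hc t ht).tendsto.mono_left (nhdsWithin_mono _ Ioo_subset_Icc_self)
      have hL : Tendsto (fun s => inner ℝ (W s - W 0) (S.j x)) (𝓝[<] t)
          (𝓝 (inner ℝ (W t - W 0) (S.j x))) :=
        (hWT.sub tendsto_const_nhds).inner tendsto_const_nhds
      refine tendsto_nhds_unique hL (hR.congr' ?_)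
      filter_upwards [Ioo_mem_nhdsLT hT] with s hs
      exact ((hsolW s hs.1 hs.2).evol.inner_eq s ⟨hs.1.le, le_rfl⟩ x).symm

end ControlSystem

/-! ### Compactness of feasible times and the optimal control problems -/

section PointwiseConstraints

variable {α E : Type*} [MeasurableSpace α] {μ : Measure α} [NormedAddCommGroup E]
  [NormedSpace ℝ E] {K : α → Set E}

theorem convex_setOf_ae_mem (hK : ∀ x, Convex ℝ (K x)) :
    Convex ℝ {u : Lp E 2 μ | ∀ᵐ x ∂μ, u x ∈ K x} := by
  intro u hu v hv a b ha hb hab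
  filter_upwards [hu, hv, Lp.coeFn_add (a • u) (b • v), Lp.coeFn_smul a u, Lp.coeFn_smul b v]
    with x h1 h2 h3 h4 h5
  rw [h3, Pi.add_apply, h4, h5]
  exact hK x h1 h2 ha hb hab

omit [NormedSpace ℝ E] in
theorem isClosed_setOf_ae_mem (hK : ∀ x, IsClosed (K x)) :
    IsClosed {u : Lp E 2 μ | ∀ᵐ x ∂μ, u x ∈ K x} := by
  refine isClosed_of_closure_subset fun u hu => ?_
  obtain ⟨x, hx, hlim⟩ := mem_closure_iff_seq_limit.1 hu
  obtain ⟨ns, -, hns⟩ := (tendstoInMeasure_of_tendsto_Lp hlim).exists_seq_tendsto_ae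
  have hall : ∀ᵐ t ∂μ, ∀ n, x n t ∈ K t := ae_all_iff.2 fun n => hx n
  filter_upwards [hns, hall] with t h1 h2
  exact (hK t).mem_of_tendsto h1 (.of_forall fun i => h2 (ns i))

end PointwiseConstraints

namespace ControlSystem

variable {V H Ω : Type*}
  [NormedAddCommGroup V] [InnerProductSpace ℝ V] [CompleteSpace V]
  [NormedAddCommGroup H] [InnerProductSpace ℝ H] [CompleteSpace H]
  [MeasurableSpace Ω] {ρ : Measure Ω} (S : ControlSystem V H ρ)

theorem convex_Uad : Convex ℝ S.Uad :=
  convex_setOf_ae_mem (K := fun x => Icc (S.ua x) (S.ub x)) fun _ => convex_Icc _ _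

theorem isClosed_Uad : IsClosed S.Uad :=
  isClosed_setOf_ae_mem (K := fun x => Icc (S.ua x) (S.ub x)) fun _ => isClosed_Icc

theorem convex_UadT (T : ℝ) : Convex ℝ (S.UadT T) :=
  convex_setOf_ae_mem (K := fun _ => S.Uad) fun _ => S.convex_Uad

theorem isClosed_UadT (T : ℝ) : IsClosed (S.UadT T) :=
  isClosed_setOf_ae_mem (K := fun _ => S.Uad) fun _ => S.isClosed_Uad

/-- The controls on `(0, T)` which can be steered up to time `s` such that the components of
`w(s) - y_d` are bounded as prescribed by `M` and `N`. The bounds are imposed on the components,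
since only weak information on the states at time `s` is available. -/
def approxSet (T s M N : ℝ) : Set (Control ρ T) :=
  {u | ∃ w v, S.IsSolution s (fun t => S.B (u t)) w v ∧ w 0 = S.y₀ ∧
    ∀ x, |inner ℝ (w s - S.yd) (S.j x)| ≤ M * ‖S.j x‖ + N * ‖x‖}

variable {S}

theorem convex_approxSet {T s : ℝ} (hs : s ≤ T) (M N : ℝ) : Convex ℝ (S.approxSet T s M N) := by
  rintro u₁ ⟨w₁, v₁, h₁, h₁0, hb₁⟩ u₂ ⟨w₂, v₂, h₂, h₂0, hb₂⟩ a b ha hb hab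
  refine ⟨_, _, (h₁.linearComb h₂ a b).congr_ae ?_, ?_, fun x => ?_⟩
  · filter_upwards [ae_mono (timeMeasure_mono hs) (Lp.coeFn_add (a • u₁) (b • u₂)),
      ae_mono (timeMeasure_mono hs) (Lp.coeFn_smul a u₁),
      ae_mono (timeMeasure_mono hs) (Lp.coeFn_smul b u₂)] with t h3 h4 h5
    rw [h3, Pi.add_apply, h4, h5]
    simp
  · simp only [h₁0, h₂0]
    rw [← add_smul, hab, one_smul]
  · have e : a • w₁ s + b • w₂ s - S.yd = a • (w₁ s - S.yd) + b • (w₂ s - S.yd) := by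
      rw [smul_sub, smul_sub, ← add_sub_add_comm, ← add_smul, hab, one_smul]
    rw [e, inner_add_left, real_inner_smul_left, real_inner_smul_left]
    calc _ ≤ a * |inner ℝ (w₁ s - S.yd) (S.j x)| + b * |inner ℝ (w₂ s - S.yd) (S.j x)| := by
          refine (abs_add_le _ _).trans (le_of_eq ?_)
          rw [abs_mul, abs_mul, abs_of_nonneg ha, abs_of_nonneg hb]
      _ ≤ a * (M * ‖S.j x‖ + N * ‖x‖) + b * (M * ‖S.j x‖ + N * ‖x‖) := by
          have := hb₁ x
          have := hb₂ x
          gcongr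
      _ = _ := by rw [← add_mul, hab, one_mul]

theorem mem_approxSet_of_tendsto {T s M N : ℝ} (hs0 : 0 ≤ s) (hs : s ≤ T)
    {p : ℕ → Control ρ T} {c : Control ρ T} (hp : ∀ k, p k ∈ S.approxSet T s M N)
    (hlim : Tendsto p atTop (𝓝 c)) : c ∈ S.approxSet T s M N := by
  choose w v h h0 hb using hp
  have hle := timeMeasure_mono hs
  have hlim' : Tendsto (fun k => eLpNorm ((fun t => S.B (p k t)) - fun t => S.B (c t)) 2
      (timeMeasure s)) atTop (𝓝 0) := by
    have h1 := ENNReal.Tendsto.const_mul ((Lp.tendsto_Lp_iff_tendsto_eLpNorm' p c).1 hlim)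
      (Or.inr (ENNReal.ofReal_ne_top (r := ‖S.B‖)))
    rw [mul_zero] at h1
    refine tendsto_of_tendsto_of_tendsto_of_le_of_le tendsto_const_nhds h1
      (fun _ => bot_le) fun k => ?_
    refine (eLpNorm_mono_measure _ hle).trans ?_
    refine eLpNorm_le_mul_eLpNorm_of_ae_le_mul (.of_forall fun τ => ?_) 2
    rw [Pi.sub_apply, ← map_sub]
    exact S.B.le_opNorm _
  obtain ⟨w', v', h', hw'⟩ := exists_isSolution_of_tendsto hs0 h h0
    ((memLp_B_comp (Lp.memLp c)).mono_measure hle) hlim'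
  refine ⟨w', v', h', ?_, fun x => ?_⟩
  · refine tendsto_nhds_unique (hw' 0 ⟨le_rfl, hs0⟩) ?_
    simp only [h0]
    exact tendsto_const_nhds
  · have h1 : Tendsto (fun k => |inner ℝ (w k s - S.yd) (S.j x)|) atTop
        (𝓝 |inner ℝ (w' s - S.yd) (S.j x)|) :=
      (((hw' s ⟨hs0, le_rfl⟩).sub tendsto_const_nhds).inner tendsto_const_nhds).abs
    exact le_of_tendsto' h1 fun k => hb k x

/-- Since `U_ad` is bounded, the states of all admissible controls on intervals of bounded length
are Hölder continuous in `V*` with a common constant. -/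
theorem exists_holder_bound_of_isBounded (hbdd : Bornology.IsBounded S.Uad) (T₁ : ℝ) :
    ∃ C : ℝ, 0 ≤ C ∧ ∀ T ∈ Icc 0 T₁, ∀ (u : Control ρ T) (y : ℝ → H) (v : ℝ → V), u ∈ S.UadT T →
      S.IsSolution T (fun t => S.B (u t)) y v → y 0 = S.y₀ →
      ∀ s t, 0 ≤ s → s ≤ t → t ≤ T → ∀ x,
        |inner ℝ (y t - y s) (S.j x)| ≤ C * √(t - s) * ‖x‖ := by
  obtain ⟨R, hR⟩ := hbdd.exists_norm_le
  obtain ⟨C, hC0, hC⟩ := S.exists_holder_bound T₁ (‖S.B‖ * R) S.y₀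
  refine ⟨C, hC0, fun T hT u y v hu h h0 => hC T hT _ y v h h0 ?_⟩
  filter_upwards [show ∀ᵐ t ∂(timeMeasure T), u t ∈ S.Uad from hu] with t ht
  exact (S.B.le_opNorm _).trans (mul_le_mul_of_nonneg_left (hR _ ht) (norm_nonneg _))

/-- The final times of controls steering into target sets with radii tending to a value below
`‖y₀ - y_d‖` stay away from zero. -/
theorem pos_of_tendsto_isFeasible (hbdd : Bornology.IsBounded S.Uad) {δ T : ℕ → ℝ} {δ' T' T₁ : ℝ}
    (hT₁ : ∀ n, T n ≤ T₁) {u : ∀ n, Control ρ (T n)} (hu : ∀ n, S.IsFeasible (δ n) (T n) (u n))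
    (hTlim : Tendsto T atTop (𝓝 T')) (hδlim : Tendsto δ atTop (𝓝 δ')) (hδ0 : 0 ≤ δ')
    (hδ' : δ' < S.deltaBullet) : 0 < T' := by
  have hT'0 : 0 ≤ T' := ge_of_tendsto' hTlim fun n => (hu n).1.le
  refine lt_of_le_of_ne hT'0 fun hzero => ?_
  obtain ⟨C, hC0, hC⟩ := exists_holder_bound_of_isBounded hbdd T₁
  have hM : ‖S.y₀ - S.yd‖ ≤ S.δ₀ + δ' := by
    refine norm_le_of_dense_inner_le S.j_denseRange (add_nonneg S.δ₀_pos.le hδ0) fun x => ?_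
    have hlim : Tendsto (fun n => (S.δ₀ + δ n) * ‖S.j x‖ + C * √(T n - 0) * ‖x‖) atTop
        (𝓝 ((S.δ₀ + δ') * ‖S.j x‖ + C * √(0 - 0) * ‖x‖)) := by
      rw [← hzero] at hTlim
      exact ((hδlim.const_add _).mul_const _).add
        (((Real.continuous_sqrt.tendsto _).comp (hTlim.sub_const 0)).const_mul C |>.mul_const _)
    simp only [sub_self, Real.sqrt_zero, mul_zero, zero_mul, add_zero] at hlim
    refine ge_of_tendsto' hlim fun n => ?_
    obtain ⟨hpos, had, y, hy, hend⟩ := hu n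
    obtain ⟨v, hv⟩ := hy.exists_isSolution hpos
    have h1 := hC (T n) ⟨hpos.le, hT₁ n⟩ (u n) y v had hv hy.2.1 0 (T n) le_rfl hpos.le le_rfl x
    rw [hy.2.1] at h1
    have h2 : |inner ℝ (y (T n) - S.yd) (S.j x)| ≤ (S.δ₀ + δ n) * ‖S.j x‖ :=
      (abs_real_inner_le_norm _ _).trans (mul_le_mul_of_nonneg_right hend (norm_nonneg _))
    have e : inner ℝ (S.y₀ - S.yd) (S.j x)
        = inner ℝ (y (T n) - S.yd) (S.j x) - inner ℝ (y (T n) - S.y₀) (S.j x) := by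
      rw [← inner_sub_left]; congr 1; abel
    rw [e]
    exact (abs_sub _ _).trans (add_le_add h2 h1)
  unfold deltaBullet at hδ'
  linarith

/-- Limits of feasible times are feasible for the limit of the tolerances. The control at the limit
time is a strong limit of convex combinations of the given controls. -/
theorem exists_isFeasible_of_tendsto (hbdd : Bornology.IsBounded S.Uad) {δ T : ℕ → ℝ}
    {δ' T' T₁ : ℝ} (hT₁ : ∀ n, T n ≤ T₁) {u : ∀ n, Control ρ (T n)}
    (hu : ∀ n, S.IsFeasible (δ n) (T n) (u n)) (hTlim : Tendsto T atTop (𝓝 T')) (hT' : 0 < T')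
    (hδlim : Tendsto δ atTop (𝓝 δ')) (hδ0 : 0 ≤ δ') :
    ∃ u' : Control ρ T', S.IsFeasible δ' T' u' := by
  obtain ⟨R, hR⟩ := hbdd.exists_norm_le
  obtain ⟨C, hC0, hC⟩ := exists_holder_bound_of_isBounded hbdd T₁
  have had : ∀ n, ∀ᵐ t ∂(timeMeasure (T n)), u n t ∈ S.Uad := fun n => (hu n).2.1
  have hstate : ∀ n, ∃ y v, S.IsSolution (T n) (fun t => S.B (u n t)) y v ∧ y 0 = S.y₀ ∧
      ‖y (T n) - S.yd‖ ≤ S.δ₀ + δ n := fun n => by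
    obtain ⟨hpos, -, y, hy, hend⟩ := hu n
    obtain ⟨v, hv⟩ := hy.exists_isSolution hpos
    exact ⟨y, v, hv, hy.2.1, hend⟩
  choose y v hsol hy0 hend using hstate
  -- the controls are extended by a constant admissible value
  obtain ⟨w₀, hw₀⟩ : S.Uad.Nonempty := by
    have hne : timeMeasure (T 0) ≠ 0 := by
      rw [Ne, Measure.restrict_eq_zero, Real.volume_Ioo]
      simp [(hu 0).1]
    have : (ae (timeMeasure (T 0))).NeBot := ae_neBot.2 hne
    obtain ⟨t, ht⟩ := (had 0).exists
    exact ⟨_, ht⟩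
  let U : ℕ → ℝ → Lp ℝ 2 ρ := fun n => (Iio (T n)).piecewise (u n) fun _ => w₀
  have hres : ∀ n, (timeMeasure T').restrict (Iio (T n)) ≤ timeMeasure (T n) := fun n => by
    rw [Measure.restrict_restrict measurableSet_Iio]
    have hsub : Iio (T n) ∩ Ioo 0 T' ⊆ Ioo 0 (T n) := fun t ht => ⟨ht.2.1, ht.1⟩
    exact Measure.restrict_mono hsub le_rfl
  have hUad : ∀ n, ∀ᵐ t ∂(timeMeasure T'), U n t ∈ S.Uad := fun n => by
    have h1 := (ae_restrict_iff' measurableSet_Ioo).1 (had n)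
    rw [ae_restrict_iff' measurableSet_Ioo]
    filter_upwards [h1] with t ht htm
    by_cases hlt : t ∈ Iio (T n)
    · simp only [U]
      rw [piecewise_eq_of_mem _ _ _ hlt]
      exact ht ⟨htm.1, hlt⟩
    · simp only [U]
      rw [piecewise_eq_of_notMem _ _ _ hlt]
      exact hw₀
  have hUm : ∀ n, MemLp (U n) 2 (timeMeasure T') := fun n => by
    refine MemLp.of_bound (AEStronglyMeasurable.piecewise measurableSet_Iio
      ((Lp.memLp (u n)).1.mono_measure (hres n)) aestronglyMeasurable_const) R ?_
    filter_upwards [hUad n] with t ht using hR _ ht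
  have hnorm : ∀ n, ‖(hUm n).toLp (U n)‖ ≤ (timeMeasure T' univ).toNNReal ^ (1 / 2 : ℝ) * R := by
    intro n
    have := Lp.norm_le_of_ae_bound (f := (hUm n).toLp (U n)) (C := R)
      ((norm_nonneg _).trans (hR _ hw₀)) (by
        filter_upwards [(hUm n).coeFn_toLp, hUad n] with t h1 h2
        rw [h1]; exact hR _ h2)
    simpa [measureUnivNNReal] using this
  obtain ⟨p, c, hp, hpc⟩ := exists_tendsto_convexHull_tail hnorm
  have hcad : c ∈ S.UadT T' := by
    refine (S.isClosed_UadT T').mem_of_tendsto hpc (.of_forall fun k => ?_)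
    refine convexHull_min ?_ (S.convex_UadT T') (hp k)
    rintro _ ⟨n, -, rfl⟩
    show ∀ᵐ t ∂(timeMeasure T'), (hUm n).toLp (U n) t ∈ S.Uad
    filter_upwards [(hUm n).coeFn_toLp, hUad n] with t h1 h2
    rwa [h1]
  -- the limit control steers the system on each shorter interval
  have hmem : ∀ s, 0 < s → s < T' →
      c ∈ S.approxSet T' s (S.δ₀ + δ' + (T' - s)) (C * √(2 * (T' - s))) := by
    intro s hs0 hsT
    have hη : 0 < T' - s := sub_pos.2 hsT
    obtain ⟨N, hN⟩ := eventually_atTop.1 (((hTlim.eventually_const_lt hsT).and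
      (hTlim.eventually_lt_const (lt_add_of_pos_right T' hη))).and
      (hδlim.eventually_lt_const (lt_add_of_pos_right δ' hη)))
    have hUmem : ∀ n ≥ N, (hUm n).toLp (U n)
        ∈ S.approxSet T' s (S.δ₀ + δ' + (T' - s)) (C * √(2 * (T' - s))) := by
      intro n hn
      obtain ⟨⟨h1, h2⟩, h3⟩ := hN n hn
      refine ⟨y n, v n, ((hsol n).mono h1.le).congr_ae ?_, hy0 n, fun x => ?_⟩
      · filter_upwards [ae_mono (timeMeasure_mono hsT.le) (hUm n).coeFn_toLp,
          ae_restrict_mem measurableSet_Ioo] with t h4 h5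
        rw [h4]
        simp only [U]
        rw [piecewise_eq_of_mem _ _ _ (mem_Iio.2 (h5.2.trans h1))]
      · have h4 := hC (T n) ⟨(hu n).1.le, hT₁ n⟩ (u n) (y n) (v n) (hu n).2.1 (hsol n) (hy0 n)
          s (T n) hs0.le h1.le le_rfl x
        have h5 : |inner ℝ (y n (T n) - S.yd) (S.j x)| ≤ (S.δ₀ + δ n) * ‖S.j x‖ :=
          (abs_real_inner_le_norm _ _).trans
            (mul_le_mul_of_nonneg_right (hend n) (norm_nonneg _))
        have e : inner ℝ (y n s - S.yd) (S.j x)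
            = inner ℝ (y n (T n) - S.yd) (S.j x) - inner ℝ (y n (T n) - y n s) (S.j x) := by
          rw [← inner_sub_left]; congr 1; abel
        rw [e]
        refine (abs_sub _ _).trans (add_le_add (h5.trans ?_) (h4.trans ?_))
        · exact mul_le_mul_of_nonneg_right (by linarith) (norm_nonneg _)
        · have : √(T n - s) ≤ √(2 * (T' - s)) := Real.sqrt_le_sqrt (by linarith)
          gcongr
    refine mem_approxSet_of_tendsto hs0.le hsT.le (p := fun k => p (k + N)) (fun k => ?_)
      ((tendsto_add_atTop_iff_nat N).2 hpc)
    refine convexHull_min ?_ (convex_approxSet hsT.le _ _) (hp (k + N))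
    rintro _ ⟨n, hn, rfl⟩
    exact hUmem n ((Nat.le_add_left N k).trans hn)
  obtain ⟨w, v', hw, hw0⟩ := exists_isSolution_of_forall_lt hT'
    (memLp_B_comp (S := S) (Lp.memLp c)) fun s h1 h2 => by
      obtain ⟨w, v', h3, h4, -⟩ := hmem s h1 h2
      exact ⟨w, v', h3, h4⟩
  refine ⟨c, hT', hcad, w, IsSolution.isState hT' hw hw0, ?_⟩
  refine norm_le_of_dense_inner_le S.j_denseRange (add_nonneg S.δ₀_pos.le hδ0) fun x => ?_
  have hbound : ∀ s ∈ Ioo 0 T', |inner ℝ (w s - S.yd) (S.j x)|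
      ≤ (S.δ₀ + δ' + (T' - s)) * ‖S.j x‖ + C * √(2 * (T' - s)) * ‖x‖ := by
    intro s hs
    obtain ⟨w', v'', h1, h2, h3⟩ := hmem s hs.1 hs.2
    rw [(hw.mono hs.2.le).eqOn h1 (ae_eq_refl _) (hw0.trans h2.symm) ⟨hs.1.le, le_rfl⟩]
    exact h3 x
  have hL : ContinuousWithinAt (fun s => |inner ℝ (w s - S.yd) (S.j x)|) (Icc 0 T') T' :=
    (((hw.evol.cont.sub continuousOn_const).inner continuousOn_const).abs) T' ⟨hT'.le, le_rfl⟩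
  have hR : Continuous fun s => (S.δ₀ + δ' + (T' - s)) * ‖S.j x‖ + C * √(2 * (T' - s)) * ‖x‖ := by
    fun_prop
  have hnb : (𝓝[Ioo 0 T'] T').NeBot := by
    rw [nhdsWithin_Ioo_eq_nhdsLT hT']; infer_instance
  have := le_of_tendsto_of_tendsto (hL.mono Ioo_subset_Icc_self).tendsto
    ((hR.tendsto T').mono_left nhdsWithin_le_nhds)
    (by filter_upwards [self_mem_nhdsWithin] with s hs using hbound s hs)
  simpa using this

theorem IsFeasible.mono {δ δ' T : ℝ} {u : Control ρ T} (h : S.IsFeasible δ T u) (hle : δ ≤ δ') :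
    S.IsFeasible δ' T u := by
  obtain ⟨h1, h2, y, h3, h4⟩ := h
  exact ⟨h1, h2, y, h3, by linarith⟩

theorem timeValue_le_of_isFeasible {δ T : ℝ} {u : Control ρ T} (h : S.IsFeasible δ T u) :
    S.timeValue δ ≤ ENNReal.ofReal T :=
  iInf_le_of_le T (iInf_le_of_le u (iInf_le_of_le h le_rfl))

theorem exists_isFeasible_of_timeValue_lt {δ : ℝ} {r : ℝ≥0∞} (h : S.timeValue δ < r) :
    ∃ (T : ℝ) (u : Control ρ T), S.IsFeasible δ T u ∧ ENNReal.ofReal T < r := by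
  simp only [timeValue, iInf_lt_iff] at h
  obtain ⟨T, u, hu, hlt⟩ := h
  exact ⟨T, u, hu, hlt⟩

theorem timeValue_antitone : Antitone S.timeValue := fun _ _ h =>
  le_iInf fun _ => le_iInf fun _ => le_iInf fun hu => timeValue_le_of_isFeasible (hu.mono h)

/-- A control ending strictly closer to `y_d` at time `T` would reach the target set before `T`. -/
theorem IsTimeOptimal.isDistanceOptimal {δ T : ℝ} {u : Control ρ T} (h : S.IsTimeOptimal δ T u) :
    S.IsDistanceOptimal T u := by
  obtain ⟨⟨hT, hu, y, hy, hend⟩, hopt⟩ := h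
  refine ⟨hu, y, hy, fun u' hu' y' hy' => ?_⟩
  by_contra hlt
  obtain ⟨T', hT'T, u'', hf⟩ := exists_isFeasible_lt (δ := δ) hT hu' hy' (by linarith)
  exact absurd (hopt T' u'' hf) (not_le.2 hT'T)

theorem distanceValue_eq {T : ℝ} {u : Control ρ T} {y : ℝ → H} (hu : u ∈ S.UadT T)
    (hy : S.IsState T u y) (hopt : ∀ u' ∈ S.UadT T, ∀ y' : ℝ → H, S.IsState T u' y' →
      ‖y T - S.yd‖ - S.δ₀ ≤ ‖y' T - S.yd‖ - S.δ₀) :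
    S.distanceValue T = ‖y T - S.yd‖ - S.δ₀ := by
  refine IsLeast.csInf_eq ⟨⟨u, hu, y, hy, rfl⟩, ?_⟩
  rintro _ ⟨u', hu', y', hy', rfl⟩
  exact hopt u' hu' y' hy'

/-- The largest tolerance `δ ≥ 0` for which at least the time `T` is needed; it exists because the
time value function is left-continuous. -/
theorem exists_critical_tolerance
    (hleft : ∀ δ : ℝ, 0 < δ → ContinuousWithinAt S.timeValue (Iic δ) δ)
    (h0 : S.timeValue S.deltaBullet = 0) {T : ℝ} (hT : 0 < T)
    (hle : ENNReal.ofReal T ≤ S.timeValue 0) :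
    ∃ δ, 0 ≤ δ ∧ δ < S.deltaBullet ∧ ENNReal.ofReal T ≤ S.timeValue δ ∧
      ∀ δ' > δ, S.timeValue δ' < ENNReal.ofReal T := by
  let A : Set ℝ := {δ | 0 ≤ δ ∧ ENNReal.ofReal T ≤ S.timeValue δ}
  have h0A : (0 : ℝ) ∈ A := ⟨le_rfl, hle⟩
  have hlt : ∀ δ, ENNReal.ofReal T ≤ S.timeValue δ → δ < S.deltaBullet := by
    intro δ hδ
    by_contra hcon
    have := hδ.trans (timeValue_antitone (not_lt.1 hcon))
    rw [h0] at this
    exact absurd (ENNReal.ofReal_pos.2 hT) (not_lt.2 this)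
  have hbdd : BddAbove A := ⟨_, fun δ hδ => (hlt δ hδ.2).le⟩
  have hδ0 : 0 ≤ sSup A := le_csSup hbdd h0A
  have hmem : ENNReal.ofReal T ≤ S.timeValue (sSup A) := by
    rcases hδ0.eq_or_lt with h | hpos
    · rw [← h]; exact hle
    have hc := (hleft _ hpos).mono Iio_subset_Iic_self
    refine ge_of_tendsto hc.tendsto ?_
    filter_upwards [self_mem_nhdsWithin] with δ hδ
    obtain ⟨δ', hδ', hlt'⟩ := exists_lt_of_lt_csSup ⟨0, h0A⟩ hδ
    exact hδ'.2.trans (timeValue_antitone hlt'.le)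
  refine ⟨sSup A, hδ0, hlt _ hmem, hmem, fun δ' hδ' => ?_⟩
  by_contra hcon
  exact absurd (le_csSup hbdd ⟨hδ0.trans hδ'.le, not_lt.1 hcon⟩) (not_le.2 hδ')

theorem IsDistanceOptimal.distanceValue_nonneg_and_isTimeOptimal
    (hbdd : Bornology.IsBounded S.Uad)
    (hleft : ∀ δ : ℝ, 0 < δ → ContinuousWithinAt S.timeValue (Iic δ) δ)
    (h0 : S.timeValue S.deltaBullet = 0) {T : ℝ} {u : Control ρ T} (hT : 0 < T)
    (hle : ENNReal.ofReal T ≤ S.timeValue 0) (h : S.IsDistanceOptimal T u) :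
    0 ≤ S.distanceValue T ∧ S.IsTimeOptimal (S.distanceValue T) T u := by
  obtain ⟨hu, y, hy, hopt⟩ := h
  rw [distanceValue_eq hu hy hopt]
  have hnn : 0 ≤ ‖y T - S.yd‖ - S.δ₀ := by
    by_contra hneg
    obtain ⟨T', hT'T, u', hf⟩ := exists_isFeasible_lt (δ := 0) hT hu hy (by linarith)
    have := hle.trans (timeValue_le_of_isFeasible hf)
    exact absurd ((ENNReal.ofReal_le_ofReal_iff hf.1.le).1 this) (not_le.2 hT'T)
  refine ⟨hnn, ⟨hT, hu, y, hy, by linarith⟩, fun T' u' hf => ?_⟩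
  obtain ⟨δ, hδ0, hδlt, hTδ, hδ⟩ := exists_critical_tolerance hleft h0 hT hle
  suffices hdle : ‖y T - S.yd‖ - S.δ₀ ≤ δ by
    have := hTδ.trans ((timeValue_antitone hdle).trans (timeValue_le_of_isFeasible hf))
    exact (ENNReal.ofReal_le_ofReal_iff hf.1.le).1 this
  -- times below `T` suffice for the tolerances `δ + 1 / (n + 1)`
  have hex : ∀ n : ℕ, ∃ (T' : ℝ) (u' : Control ρ T'),
      S.IsFeasible (δ + 1 / ((n : ℝ) + 1)) T' u' ∧ ENNReal.ofReal T' < ENNReal.ofReal T := fun n =>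
    exists_isFeasible_of_timeValue_lt (hδ _ (lt_add_of_pos_right δ Nat.one_div_pos_of_nat))
  choose τ U hU hτ using hex
  have hτT : ∀ n, τ n ≤ T := fun n => ((ENNReal.ofReal_lt_ofReal_iff hT).1 (hτ n)).le
  obtain ⟨T', -, φ, hφ, hlim⟩ := (isCompact_Icc (a := (0 : ℝ)) (b := T)).tendsto_subseq
    fun n => ⟨(hU n).1.le, hτT n⟩
  have hδlim : Tendsto (fun n => δ + 1 / ((φ n : ℝ) + 1)) atTop (𝓝 δ) := by
    simpa using ((tendsto_one_div_add_atTop_nhds_zero_nat (𝕜 := ℝ)).comp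
      hφ.tendsto_atTop).const_add δ
  have hT'pos := pos_of_tendsto_isFeasible hbdd (fun n => hτT (φ n)) (fun n => hU (φ n)) hlim
    hδlim hδ0 hδlt
  obtain ⟨u'', hu''⟩ := exists_isFeasible_of_tendsto hbdd (fun n => hτT (φ n))
    (fun n => hU (φ n)) hlim hT'pos hδlim hδ0
  have hT'le : T' ≤ T := le_of_tendsto' hlim fun n => hτT (φ n)
  have hT'ge : T ≤ T' :=
    (ENNReal.ofReal_le_ofReal_iff hT'pos.le).1 (hTδ.trans (timeValue_le_of_isFeasible hu''))
  obtain rfl : T' = T := le_antisymm hT'le hT'ge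
  obtain ⟨-, had, y'', hy'', hend⟩ := hu''
  have := hopt u'' had y'' hy''
  linarith

end ControlSystem

end ParabolicControl

theorem mainTheorem1 {V H Ω : Type*}
    [NormedAddCommGroup V] [InnerProductSpace ℝ V] [CompleteSpace V]
    [NormedAddCommGroup H] [InnerProductSpace ℝ H] [CompleteSpace H]
    [MeasurableSpace Ω] {ρ : Measure Ω} (S : ParabolicControl.ControlSystem V H ρ)
    -- boundedness of the set of admissible control values in `L²(ω)`
    (hbdd : Bornology.IsBounded S.Uad)
    -- existence of a feasible point of the unperturbed problem, and its nontriviality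
    (hfeas : ∃ (T : ℝ) (u : ParabolicControl.Control ρ T), S.IsFeasible 0 T u)
    (hnontriv : S.δ₀ < ‖S.y₀ - S.yd‖)
    -- left-continuity of the time value function on `[0, ∞)`
    (hleft : ∀ δ : ℝ, 0 < δ → ContinuousWithinAt S.timeValue (Set.Iic δ) δ) :
    (S.timeValue S.deltaBullet = 0 →
      ∀ (T : ℝ) (u : ParabolicControl.Control ρ T),
        0 < T → ENNReal.ofReal T ≤ S.timeValue 0 → S.IsDistanceOptimal T u →
          0 ≤ S.distanceValue T ∧ S.IsTimeOptimal (S.distanceValue T) T u) ∧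
    (∀ (δ T : ℝ) (u : ParabolicControl.Control ρ T),
        0 ≤ δ → δ < S.deltaBullet → S.IsTimeOptimal δ T u → S.IsDistanceOptimal T u) := by
  refine ⟨fun h0 T u hT hle hu => ?_, fun δ T u _ _ hu => hu.isDistanceOptimal⟩
  exact hu.distanceValue_nonneg_and_isTimeOptimal hbdd hleft h0 hT hle
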